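/- Conventions. Let $\mathcal X\subset\mathcal H\subset\mathcal X^*$ be a Gelfand triple: $\mathcal H$ is a complex Hilbert space, $\mathcal X$ is continuously and densely embedded in $\mathcal H$, $\mathcal X^*$ is the conjugate dual of $\mathcal X$, and the map $\mathcal H\to\mathcal X^*$, $\varphi\mapsto\langle\,\cdot\,,\varphi\rangle$, has dense range. Write $\|\cdot\|_{\mathcal X,\mathcal X^*}$ for the norm of $\mathfrak B(\mathcal X,\mathcal X^*)$, and $R(z)=(H-z)^{-1}$ for the resolvent of a self-adjoint operator $H$ on $\mathcal H$. $H$ is called $\mathcal X$-smooth with respect to an open set $U\subset\mathbb R$ of full Lebesgue measure if the limits $R(\lambda\pm i0)=\lim_{\epsilon\downarrow0}R(\lambda\pm i\epsilon)$, $\lambda\in U$, exist in $\mathfrak B(\mathcal X,\mathcal X^*)$ and the extended functions $R:(\mathbb R\pm i(0,\infty))\cup U\to\mathfrak B(\mathcal X,\mathcal X^*)$ are locally Hölder continuous; $H$ is $\mathcal X$-smooth if this holds for some such $U$. For $\beta\in(0,1)$, an $\mathcal X$-smooth operator $H$ is of high-energy order $\beta$ if there are $\hat\lambda,b>0$ with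 $\|R(\lambda\pm i0)\|_{\mathcal X,\mathcal X^*}\le b|\lambda|^{-\beta}$ for all $\lambda\in U$ with $|\lambda|\ge\hat\lambda$. Theorem. Let $\mathcal X_A\subset\mathcal H_A\subset\mathcal X_A^*$ be a Gelfand triple with $\mathcal X_A$ a Hilbert space, let $H_A$ be a self-adjoint operator on $\mathcal H_A$ with resolvent $R_A$, and let $H_B$ be a self-adjoint operator on a Hilbert space $\mathcal H_B$. Suppose that: (a) $H_A$ is $\mathcal X_A$-smooth with respect to a set $U_A$ whose complement $\mathbb R\setminus U_A$ is finite. (b) There exist $\Lambda>0$, $\theta\in(0,1)$, $c>0$ and $\epsilon>0$ such that, for each choice of the sign $\pm$ and all $z,z'\in(\mathbb R\pm i(0,\infty))\cup U_A$ with $|\operatorname{Re}z|,|\operatorname{Re}z'|\ge\Lambda$, $\pm\operatorname{Im}z,\pm\operatorname{Im}z'\in[0,\epsilon]$ and $|z-z'|\le1$, one has $\|R_A(z)-R_A(z')\|_{\mathcal X_A,\mathcal X_A^*}\le c|z-z'|^\theta$, where $R_A(z)$ denotes $R_A(z\pm i0)$ if $z$ is real. (c) There exist $c>0$ and $\beta\in(0,1)$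 such that $\|R_A(\lambda\pm i0)\|_{\mathcal X_A,\mathcal X_A^*}\le c(1+\lambda^2)^{-\beta/2}$ for all $\lambda\in U_A$. (d) There exists $\gamma>0$ such that $(1+H_B^2)^{-\gamma+\beta/2}$ is of trace class. Set $\mathcal H:=\mathcal H_A\otimes\mathcal H_B$ (Hilbert space tensor product), and let $\mathcal X\subset\mathcal H$ be the Hilbert space tensor product of $\mathcal X_A$ with the domain of $(1+H_B^2)^{\gamma/2}$ normed by $\|(1+H_B^2)^{\gamma/2}\,\cdot\,\|_{\mathcal H_B}$, that is, the space with the norm $$\|\cdot\|_{\mathcal X}=\|\cdot\|_{\mathcal X_A}\otimes\|(1+H_B^2)^{\gamma/2}\,\cdot\,\|_{\mathcal H_B}.$$ Then the operator $H:=H_A\otimes\mathbf 1+\mathbf 1\otimes H_B$, i.e. the closure of the operator so defined on the algebraic tensor product of the domains of $H_A$ and $H_B$, is self-adjoint, $\mathcal X$-smooth and of high-energy order $\beta$. -/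

import Mathlib

noncomputable section

namespace SmoothMethod

open Filter Topology Complex
open scoped NNReal TensorProduct InnerProductSpace LinearPMap

/-! ### Resolvents of unbounded operators -/

section Resolvent

variable {E : Type*} [NormedAddCommGroup E] [InnerProductSpace ℂ E]

/-- The bounded, everywhere defined operator `R` is the two-sided inverse of `T - z`. -/
structure IsResolventAt (T : E →ₗ.[ℂ] E) (z : ℂ) (R : E →L[ℂ] E) : Prop where
  mem_domain : ∀ y : E, R y ∈ T.domain
  right_inv : ∀ y : E, T ⟨R y, mem_domain y⟩ - z • R y = y
  left_inv : ∀ x : T.domain, R (T x - z • (x : E)) = x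

theorem IsResolventAt.unique {T : E →ₗ.[ℂ] E} {z : ℂ} {R S : E →L[ℂ] E}
    (hR : IsResolventAt T z R) (hS : IsResolventAt T z S) : R = S := by
  ext y
  have h := hS.left_inv ⟨R y, hR.mem_domain y⟩
  rw [hR.right_inv y] at h
  exact h.symm

open Classical in
/-- The resolvent `R(z) = (T - z)⁻¹`, for `z` in the resolvent set of `T` (and `0` otherwise). -/
def opResolvent (T : E →ₗ.[ℂ] E) (z : ℂ) : E →L[ℂ] E :=
  if h : ∃ R : E →L[ℂ] E, IsResolventAt T z R then h.choose else 0

variable [CompleteSpace E]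

theorem inner_symm_of_isSelfAdjoint {T : E →ₗ.[ℂ] E} (hT : IsSelfAdjoint T) (x y : T.domain) :
    ⟪T x, (y : E)⟫_ℂ = ⟪(x : E), T y⟫_ℂ := by
  have h := LinearPMap.adjoint_isFormalAdjoint hT.dense_domain
  rw [LinearPMap.isSelfAdjoint_def.mp hT] at h
  exact h x y

theorem norm_le_of_isSelfAdjoint {T : E →ₗ.[ℂ] E} (hT : IsSelfAdjoint T) (z : ℂ) (x : T.domain) :
    |z.im| * ‖(x : E)‖ ≤ ‖T x - z • (x : E)‖ := by
  have hreal : (⟪(x : E), T x⟫_ℂ).im = 0 := by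
    have h1 := inner_symm_of_isSelfAdjoint hT x x
    have h2 := congrArg Complex.im h1
    rw [← inner_conj_symm, Complex.conj_im] at h2
    linarith
  have h3 : (⟪(x : E), T x - z • (x : E)⟫_ℂ).im = -(z.im * ‖(x : E)‖ ^ 2) := by
    rw [inner_sub_right, inner_smul_right, inner_self_eq_norm_sq_to_K, Complex.sub_im, hreal]
    have : ((‖(x : E)‖ : ℂ) ^ 2) = ((‖(x : E)‖ ^ 2 : ℝ) : ℂ) := by push_cast; rfl
    change (0 : ℝ) - (z * (‖(x : E)‖ : ℂ) ^ 2).im = _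
    rw [this, Complex.im_mul_ofReal]
    ring
  have h4 : |z.im| * ‖(x : E)‖ ^ 2 ≤ ‖(x : E)‖ * ‖T x - z • (x : E)‖ := by
    calc |z.im| * ‖(x : E)‖ ^ 2 = |(⟪(x : E), T x - z • (x : E)⟫_ℂ).im| := by
          rw [h3, abs_neg, abs_mul, abs_of_nonneg (sq_nonneg ‖(x : E)‖)]
      _ ≤ ‖⟪(x : E), T x - z • (x : E)⟫_ℂ‖ := Complex.abs_im_le_norm _
      _ ≤ _ := norm_inner_le_norm _ _
  rcases (norm_nonneg (x : E)).eq_or_lt with h0 | h0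
  · rw [← h0, mul_zero]; exact norm_nonneg _
  · nlinarith

/-- A self-adjoint operator has a bounded resolvent at every non-real point. -/
theorem exists_isResolventAt {T : E →ₗ.[ℂ] E} (hT : IsSelfAdjoint T) {z : ℂ} (hz : z.im ≠ 0) :
    ∃ R : E →L[ℂ] E, IsResolventAt T z R := by
  have hclosed : IsClosed (T.graph : Set (E × E)) := hT.isClosed
  have : CompleteSpace T.graph := hclosed.completeSpace_coe
  let f : T.graph →L[ℂ] E :=
    (ContinuousLinearMap.snd ℂ E E - z • ContinuousLinearMap.fst ℂ E E).comp T.graph.subtypeL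
  have hf : ∀ p : T.graph, f p = (p : E × E).2 - z • (p : E × E).1 := fun _ => rfl
  have hpos : 0 < |z.im| := abs_pos.mpr hz
  have hbound : ∀ p : T.graph, ‖p‖ ≤ (1 + (1 + ‖z‖) / |z.im|) * ‖f p‖ := by
    rintro ⟨⟨x, w⟩, hp⟩
    obtain ⟨x', hx, hw⟩ := (LinearPMap.mem_graph_iff T).mp hp
    simp only at hx hw
    subst hx hw
    have h1 := norm_le_of_isSelfAdjoint hT z x'
    rw [hf]
    change ‖((x' : E), T x')‖ ≤ (1 + (1 + ‖z‖) / |z.im|) * ‖T x' - z • (x' : E)‖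
    set N := ‖T x' - z • (x' : E)‖
    have h2 : ‖(x' : E)‖ ≤ N / |z.im| := by
      rw [le_div_iff₀ hpos]; linarith
    have h3 : ‖T x'‖ ≤ N + ‖z‖ * ‖(x' : E)‖ := by
      have : T x' = (T x' - z • (x' : E)) + z • (x' : E) := by abel
      calc ‖T x'‖ = ‖(T x' - z • (x' : E)) + z • (x' : E)‖ := by rw [← this]
        _ ≤ _ := (norm_add_le _ _).trans (by rw [norm_smul])
    have hN : 0 ≤ N := norm_nonneg _
    have h4 : ‖z‖ * ‖(x' : E)‖ ≤ ‖z‖ * (N / |z.im|) := by gcongr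
    have h5 : (1 + (1 + ‖z‖) / |z.im|) * N = N + N / |z.im| + ‖z‖ * (N / |z.im|) := by
      field_simp
      ring
    have h6 : 0 ≤ N / |z.im| := by positivity
    have h7 : 0 ≤ ‖z‖ * (N / |z.im|) := by positivity
    rw [Prod.norm_def, h5]
    exact max_le (by linarith) (by linarith)
  have hanti : AntilipschitzWith (Real.toNNReal (1 + (1 + ‖z‖) / |z.im|)) f := by
    refine AddMonoidHomClass.antilipschitz_of_bound f fun p => ?_
    rw [Real.coe_toNNReal _ (by positivity)]
    exact hbound p
  have hker : f.ker = ⊥ := LinearMap.ker_eq_bot.mpr hanti.injective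
  have hrc : IsClosed (Set.range f) := hanti.isClosed_range f.uniformContinuous
  have hrange : f.range = ⊤ := by
    have hcl : f.range.topologicalClosure = f.range :=
      IsClosed.submodule_topologicalClosure_eq hrc
    rw [← hcl, Submodule.topologicalClosure_eq_top_iff, Submodule.eq_bot_iff]
    intro v hv
    have hv' : ∀ x : T.domain, ⟪(starRingEnd ℂ z) • v, (x : E)⟫_ℂ = ⟪v, T x⟫_ℂ := by
      intro x
      have h1 := (Submodule.mem_orthogonal' _ v).mp hv (f ⟨((x : E), T x), T.mem_graph x⟩) ⟨_, rfl⟩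
      rw [hf, inner_sub_right, inner_smul_right, sub_eq_zero] at h1
      rw [inner_smul_left, Complex.conj_conj]
      exact h1.symm
    have hmem : v ∈ T.domain := by
      rw [← LinearPMap.isSelfAdjoint_def.mp hT]
      exact LinearPMap.mem_adjoint_domain_of_exists v ⟨_, hv'⟩
    have hTv : T ⟨v, hmem⟩ = (starRingEnd ℂ z) • v := by
      refine hT.dense_domain.eq_of_inner_left ℂ fun w hw => ?_
      rw [hv' ⟨w, hw⟩]
      exact inner_symm_of_isSelfAdjoint hT ⟨v, hmem⟩ ⟨w, hw⟩
    have h2 := norm_le_of_isSelfAdjoint hT (starRingEnd ℂ z) ⟨v, hmem⟩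
    rw [hTv, sub_self, norm_zero, Complex.conj_im, abs_neg] at h2
    have h3 : ‖v‖ ≤ 0 := by
      by_contra h
      push Not at h
      have := mul_pos hpos h
      exact absurd h2 (not_le.mpr this)
    exact norm_le_zero_iff.mp h3
  let e := ContinuousLinearEquiv.ofBijective f hker hrange
  have he : ∀ p, e p = f p := fun _ => rfl
  have hRm : ∀ y, (e.symm y : E × E).1 ∈ T.domain := fun y =>
    LinearPMap.mem_domain_of_mem_graph (y := (e.symm y : E × E).2) (e.symm y).2
  refine ⟨((ContinuousLinearMap.fst ℂ E E).comp T.graph.subtypeL).comp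
    (e.symm : E →L[ℂ] T.graph), hRm, fun y => ?_, fun x => ?_⟩
  · obtain ⟨x', hx, hw⟩ := (LinearPMap.mem_graph_iff T).mp (e.symm y).2
    have h1 : f (e.symm y) = y := by rw [← he]; exact e.apply_symm_apply y
    have h2 : T ⟨(e.symm y : E × E).1, hRm y⟩ = (e.symm y : E × E).2 := by
      rw [← hw]; congr 1; exact Subtype.ext hx.symm
    change T ⟨(e.symm y : E × E).1, hRm y⟩ - z • (e.symm y : E × E).1 = y
    rw [h2, ← hf, h1]
  · have h1 : e ⟨((x : E), T x), T.mem_graph x⟩ = T x - z • (x : E) := rfl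
    change (e.symm (T x - z • (x : E)) : E × E).1 = x
    rw [← h1, e.symm_apply_apply]

theorem isResolventAt_opResolvent {T : E →ₗ.[ℂ] E} (hT : IsSelfAdjoint T) {z : ℂ}
    (hz : z.im ≠ 0) : IsResolventAt T z (opResolvent T z) := by
  have h := exists_isResolventAt hT hz
  rw [opResolvent, dif_pos h]
  exact h.choose_spec

end Resolvent

/-! ### Gelfand triples, smooth operators, high-energy order -/

section Smooth

variable {X H : Type*} [NormedAddCommGroup X] [NormedSpace ℂ X]
  [NormedAddCommGroup H] [InnerProductSpace ℂ H]

/-- For an embedding `J : X → H`, the map `H → X*`, `φ ↦ ⟨J ·, φ⟩`, into the conjugate dual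
`X* = (X →L⋆[ℂ] ℂ)` of `X`. -/
def toConjDual (J : X →L[ℂ] H) : H →L[ℂ] (X →L⋆[ℂ] ℂ) :=
  ((innerSL ℂ : H →L⋆[ℂ] H →L[ℂ] ℂ).comp J).flip

@[simp] theorem toConjDual_apply (J : X →L[ℂ] H) (φ : H) (ψ : X) :
    toConjDual J φ ψ = ⟪J ψ, φ⟫_ℂ := rfl

/-- `X ⊂ H ⊂ X*` is a Gelfand triple: `X` is continuously and densely embedded in `H` through `J`,
and the induced map `H → X*` has dense range as well. -/
structure IsGelfandTriple (J : X →L[ℂ] H) : Prop where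
  injective : Function.Injective J
  denseRange : DenseRange J
  denseRange_dual : DenseRange (toConjDual J)

/-- A bounded operator `S` of `H`, regarded as the element `ψ ↦ ⟨ · , S ψ⟩` of `𝔅(X, X*)`; its norm
is `‖S‖_{X,X*}`. -/
def toBoundedForm (J : X →L[ℂ] H) (S : H →L[ℂ] H) : X →L[ℂ] (X →L⋆[ℂ] ℂ) :=
  (toConjDual J).comp (S.comp J)

/-- The resolvent `R(z)` as an element of `𝔅(X, X*)`, extended to real points from the upper
(`s = 1`) or lower (`s = -1`) half plane: for real `z` this is the boundary value
`R(z ± i0) = lim_{ε ↓ 0} R(z ± iε)`, the limit being taken in `𝔅(X, X*)`. It is only used at real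
points where the limit exists. -/
def extResolvent (J : X →L[ℂ] H) (T : H →ₗ.[ℂ] H) (s : ℝ) (z : ℂ) : X →L[ℂ] (X →L⋆[ℂ] ℂ) :=
  if z.im = 0 then
    limUnder (𝓝[>] (0 : ℝ)) fun ε => toBoundedForm J (opResolvent T (z + ((s * ε : ℝ) : ℂ) * I))
  else toBoundedForm J (opResolvent T z)

/-- The open half plane `ℝ ± i(0,∞)` together with the subset `U` of its boundary. -/
def halfPlaneWith (s : ℝ) (U : Set ℝ) : Set ℂ :=
  {z | 0 < s * z.im ∨ (z.im = 0 ∧ z.re ∈ U)}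

/-- Local Hölder continuity on `S`; constant and exponent may depend on the point. -/
def LocallyHolderOn {Y : Type*} [PseudoEMetricSpace Y] (F : ℂ → Y) (S : Set ℂ) : Prop :=
  ∀ z ∈ S, ∃ C θ : ℝ≥0, 0 < θ ∧ θ ≤ 1 ∧ ∃ V ∈ 𝓝[S] z, HolderOnWith C θ F V

variable [CompleteSpace H]

/-- The operator `T` on `H` is `X`-smooth with respect to the set `U ⊂ ℝ`. -/
structure IsSmoothOn (J : X →L[ℂ] H) (T : H →ₗ.[ℂ] H) (U : Set ℝ) : Prop where
  gelfand : IsGelfandTriple J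
  selfAdjoint : IsSelfAdjoint T
  isOpen : IsOpen U
  fullMeasure : MeasureTheory.volume Uᶜ = 0
  exists_limit : ∀ s : ℝ, s = 1 ∨ s = -1 → ∀ l ∈ U, ∃ L : X →L[ℂ] (X →L⋆[ℂ] ℂ),
    Tendsto (fun ε : ℝ => toBoundedForm J (opResolvent T ((l : ℂ) + ((s * ε : ℝ) : ℂ) * I)))
      (𝓝[>] 0) (𝓝 L)
  holder : ∀ s : ℝ, s = 1 ∨ s = -1 →
    LocallyHolderOn (extResolvent J T s) (halfPlaneWith s U)

/-- The bound `‖R(λ ± i0)‖_{X,X*} ≤ b |λ|^{-β}` for all `λ ∈ U` with `|λ|` large. -/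
def IsOfHighEnergyOrderOn (J : X →L[ℂ] H) (T : H →ₗ.[ℂ] H) (U : Set ℝ) (β : ℝ) : Prop :=
  ∃ l₀ b : ℝ, 0 < l₀ ∧ 0 < b ∧ ∀ s : ℝ, s = 1 ∨ s = -1 → ∀ l ∈ U, l₀ ≤ |l| →
    ‖extResolvent J T s (l : ℂ)‖ ≤ b * |l| ^ (-β)

end Smooth

/-! ### Trace class operators and powers of `1 + T²` -/

section Powers

variable {E : Type*} [NormedAddCommGroup E] [InnerProductSpace ℂ E] [CompleteSpace E]

/-- `S` is of trace class: `∑ ⟨eᵢ, |S| eᵢ⟩ < ∞` for an orthonormal basis `(eᵢ)`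
(indexed, without loss of generality, by itself). -/
def IsTraceClass (S : E →L[ℂ] E) : Prop :=
  ∃ (w : Set E) (e : HilbertBasis w ℂ E), Summable fun i : w => (⟪e i, CFC.abs S (e i)⟫_ℂ).re

/-- A possibly unbounded operator is of trace class if it is everywhere defined, bounded and of
trace class. -/
def IsTraceClassPMap (T : E →ₗ.[ℂ] E) : Prop :=
  ∃ S : E →L[ℂ] E, T = S.toPMap ⊤ ∧ IsTraceClass S

/-- The bounded operator `(1 + T²)⁻¹ = (T + i)⁻¹ (T - i)⁻¹`. -/
def invOneAddSq (T : E →ₗ.[ℂ] E) : E →L[ℂ] E :=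
  opResolvent T (-I) * opResolvent T I

/-- The real power `(1 + T²)^p` of the self-adjoint operator `1 + T² ≥ 1`. For `p ≤ 0` it is the
bounded operator `((1 + T²)⁻¹)^(-p)`, given by the continuous functional calculus of the bounded
positive operator `(1 + T²)⁻¹`. For `p > 0` it is the (in general unbounded) inverse of
`(1 + T²)^(-p)`, with domain the range of `(1 + T²)^(-p)`. -/
def oneAddSqPow (T : E →ₗ.[ℂ] E) (p : ℝ) : E →ₗ.[ℂ] E :=
  if p ≤ 0 then ((invOneAddSq T) ^ (-p)).toPMap ⊤ else (((invOneAddSq T) ^ p).toPMap ⊤).inverse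

theorem adjoint_opResolvent {T : E →ₗ.[ℂ] E} (hT : IsSelfAdjoint T) :
    star (opResolvent T I) = opResolvent T (-I) := by
  have h1 := isResolventAt_opResolvent hT (z := I) (by simp)
  have h2 := isResolventAt_opResolvent hT (z := -I) (by simp)
  rw [ContinuousLinearMap.star_eq_adjoint, eq_comm, ContinuousLinearMap.eq_adjoint_iff]
  intro x y
  have hx := h2.right_inv x
  have hy := h1.right_inv y
  have hs := inner_symm_of_isSelfAdjoint hT ⟨_, h2.mem_domain x⟩ ⟨_, h1.mem_domain y⟩
  simp only at hs
  conv_lhs => rw [← hy]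
  conv_rhs => rw [← hx]
  rw [inner_sub_left, inner_sub_right, inner_smul_left, inner_smul_right, hs]
  simp

theorem invOneAddSq_nonneg {T : E →ₗ.[ℂ] E} (hT : IsSelfAdjoint T) : 0 ≤ invOneAddSq T := by
  rw [invOneAddSq, ← adjoint_opResolvent hT]
  exact star_mul_self_nonneg _

theorem opResolvent_injective {T : E →ₗ.[ℂ] E} (hT : IsSelfAdjoint T) {z : ℂ} (hz : z.im ≠ 0) :
    Function.Injective (opResolvent T z) := by
  have h := isResolventAt_opResolvent hT hz
  intro x y hxy
  rw [← h.right_inv x, ← h.right_inv y]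
  congr 2
  exact Subtype.ext hxy

theorem invOneAddSq_injective {T : E →ₗ.[ℂ] E} (hT : IsSelfAdjoint T) :
    Function.Injective (invOneAddSq T) :=
  (opResolvent_injective hT (z := -I) (by simp)).comp (opResolvent_injective hT (z := I) (by simp))

theorem invOneAddSq_rpow_injective {T : E →ₗ.[ℂ] E} (hT : IsSelfAdjoint T) {p : ℝ} (hp : 0 ≤ p) :
    Function.Injective ((invOneAddSq T) ^ p : E →L[ℂ] E) := by
  set D := invOneAddSq T with hD
  have hD0 : 0 ≤ D := invOneAddSq_nonneg hT
  rcases hp.eq_or_lt with rfl | hp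
  · rw [CFC.rpow_zero D hD0]
    exact Function.injective_id
  obtain ⟨n, hn⟩ := exists_nat_gt p
  have h1 : D ^ (n : ℕ) = (D ^ (n - p)) * (D ^ p) := by
    have hq : 0 < (n : ℝ) - p := sub_pos.mpr hn
    rw [← CFC.rpow_natCast D n hD0]
    have e1 : D ^ p = D ^ p.toNNReal := by
      rw [CFC.nnrpow_eq_rpow (Real.toNNReal_pos.mpr hp), Real.coe_toNNReal p hp.le]
    have e2 : D ^ ((n : ℝ) - p) = D ^ ((n : ℝ) - p).toNNReal := by
      rw [CFC.nnrpow_eq_rpow (Real.toNNReal_pos.mpr hq), Real.coe_toNNReal _ hq.le]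
    rw [e1, e2, ← CFC.nnrpow_add (Real.toNNReal_pos.mpr hq) (Real.toNNReal_pos.mpr hp),
      CFC.nnrpow_eq_rpow (add_pos (Real.toNNReal_pos.mpr hq) (Real.toNNReal_pos.mpr hp)),
      NNReal.coe_add, Real.coe_toNNReal _ hq.le, Real.coe_toNNReal p hp.le, sub_add_cancel]
  have h2 : Function.Injective (D ^ n : E →L[ℂ] E) := by
    rw [FunLike.coe_pow_eq_iterate]
    exact (invOneAddSq_injective hT).iterate n
  rw [h1] at h2
  exact Function.Injective.of_comp (f := ⇑(D ^ ((n : ℝ) - p))) h2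

theorem invOneAddSq_rpow_oneAddSqPow {T : E →ₗ.[ℂ] E} (hT : IsSelfAdjoint T) {p : ℝ} (hp : 0 < p)
    (x : (oneAddSqPow T p).domain) : ((invOneAddSq T) ^ p) (oneAddSqPow T p x) = x := by
  have hW : oneAddSqPow T p = (((invOneAddSq T) ^ p).toPMap ⊤).inverse := if_neg (not_le.mpr hp)
  have hker : LinearMap.ker ((((invOneAddSq T) ^ p).toPMap ⊤).toFun) = ⊥ := by
    refine LinearMap.ker_eq_bot.mpr fun a b hab => Subtype.ext ?_
    exact invOneAddSq_rpow_injective hT hp.le hab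
  have hg : (oneAddSqPow T p).graph = _ :=
    (congrArg LinearPMap.graph hW).trans (LinearPMap.inverse_graph hker)
  have h1 := (oneAddSqPow T p).mem_graph x
  rw [hg] at h1
  obtain ⟨⟨a, b⟩, hab, h2⟩ := Submodule.mem_map.mp h1
  obtain ⟨a', ha, hb⟩ := (LinearPMap.mem_graph_iff _).mp hab
  simp only [LinearEquiv.coe_coe, LinearEquiv.prodComm_apply, Prod.swap_prod_mk,
    Prod.mk.injEq] at h2 ha hb
  rw [← h2.1, ← h2.2, ← hb, ← ha]
  rfl

theorem oneAddSqPow_injective {T : E →ₗ.[ℂ] E} (hT : IsSelfAdjoint T) (p : ℝ) :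
    Function.Injective (oneAddSqPow T p).toFun := by
  rcases le_or_gt p 0 with hp | hp
  · have hW : oneAddSqPow T p = ((invOneAddSq T) ^ (-p)).toPMap ⊤ := if_pos hp
    rw [hW]
    exact fun a b hab => Subtype.ext (invOneAddSq_rpow_injective hT (neg_nonneg.mpr hp) hab)
  · intro x y hxy
    refine Subtype.ext ?_
    rw [← invOneAddSq_rpow_oneAddSqPow hT hp x, ← invOneAddSq_rpow_oneAddSqPow hT hp y]
    exact congrArg _ hxy

end Powers

/-! ### The weighted space and the tensor product -/

section Tensor

/-- The space `D((1 + T²)^(γ/2)) ⊂ E`, to be equipped with the norm `‖(1 + T²)^(γ/2) · ‖`. -/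
def WeightedSpace {E : Type*} [NormedAddCommGroup E] [InnerProductSpace ℂ E] [CompleteSpace E]
    (T : E →ₗ.[ℂ] E) (_hT : IsSelfAdjoint T) (γ : ℝ) : Type _ :=
  (oneAddSqPow T (γ / 2)).domain

namespace WeightedSpace

variable {E : Type*} [NormedAddCommGroup E] [InnerProductSpace ℂ E] [CompleteSpace E]
  (T : E →ₗ.[ℂ] E) (hT : IsSelfAdjoint T) (γ : ℝ)

instance : AddCommGroup (WeightedSpace T hT γ) :=
  inferInstanceAs (AddCommGroup (oneAddSqPow T (γ / 2)).domain)

instance : Module ℂ (WeightedSpace T hT γ) :=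
  inferInstanceAs (Module ℂ (oneAddSqPow T (γ / 2)).domain)

/-- The linear map `x ↦ (1 + T²)^(γ/2) x` on its domain. -/
def weight : WeightedSpace T hT γ →ₗ[ℂ] E := (oneAddSqPow T (γ / 2)).toFun

/-- The inclusion of the domain of `(1 + T²)^(γ/2)` in `E`. -/
def inclₗ : WeightedSpace T hT γ →ₗ[ℂ] E := (oneAddSqPow T (γ / 2)).domain.subtype

/-- The norm `‖x‖ = ‖(1 + T²)^(γ/2) x‖`. -/
instance : NormedAddCommGroup (WeightedSpace T hT γ) :=
  NormedAddCommGroup.induced (WeightedSpace T hT γ) E (weight T hT γ) (oneAddSqPow_injective hT _)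

theorem norm_def (x : WeightedSpace T hT γ) : ‖x‖ = ‖weight T hT γ x‖ := rfl

/-- The scalar product `⟨(1 + T²)^(γ/2) x, (1 + T²)^(γ/2) y⟩` that belongs to the norm. -/
instance : InnerProductSpace ℂ (WeightedSpace T hT γ) where
  norm_smul_le a x := by rw [norm_def, norm_def, map_smul, norm_smul]
  inner x y := ⟪weight T hT γ x, weight T hT γ y⟫_ℂ
  norm_sq_eq_re_inner x := norm_sq_eq_re_inner (𝕜 := ℂ) (weight T hT γ x)
  conj_inner_symm x y := inner_conj_symm _ _
  add_left x y z := by rw [map_add, inner_add_left]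
  smul_left x y r := by rw [map_smul, inner_smul_left]

variable {γ}

/-- The inclusion as a bounded operator, for `γ > 0`. -/
def incl (hγ : 0 < γ) : WeightedSpace T hT γ →L[ℂ] E :=
  (inclₗ T hT γ).mkContinuous ‖((invOneAddSq T) ^ (γ / 2) : E →L[ℂ] E)‖ fun x => by
    have h := invOneAddSq_rpow_oneAddSqPow hT (half_pos hγ) x
    calc ‖inclₗ T hT γ x‖ = ‖((invOneAddSq T) ^ (γ / 2)) (weight T hT γ x)‖ :=
          (congrArg norm h).symm
      _ ≤ _ := ContinuousLinearMap.le_opNorm _ _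

end WeightedSpace

variable {E F : Type*} [NormedAddCommGroup E] [InnerProductSpace ℂ E]
  [NormedAddCommGroup F] [InnerProductSpace ℂ F]

/-- The Hilbert space tensor product: the completion of the algebraic tensor product with respect to
the scalar product `⟨a ⊗ b, a' ⊗ b'⟩ = ⟨a, a'⟩ ⟨b, b'⟩`. -/
abbrev HilbertTensor (E F : Type*) [NormedAddCommGroup E] [InnerProductSpace ℂ E]
    [NormedAddCommGroup F] [InnerProductSpace ℂ F] : Type _ :=
  UniformSpace.Completion (E ⊗[ℂ] F)

/-- The tensor product `S₁ ⊗ S₂` of bounded operators. -/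
def hilbertTensorMap {E' F' : Type*} [NormedAddCommGroup E'] [InnerProductSpace ℂ E']
    [NormedAddCommGroup F'] [InnerProductSpace ℂ F'] (S₁ : E →L[ℂ] E') (S₂ : F →L[ℂ] F') :
    HilbertTensor E F →L[ℂ] HilbertTensor E' F' :=
  (TensorProduct.mapL S₁ S₂).completion

/-- The elementary tensor `a ⊗ b` as an element of the Hilbert space tensor product. -/
def hilbertTmul (a : E) (b : F) : HilbertTensor E F :=
  UniformSpace.Completion.toComplL (𝕜 := ℂ) (a ⊗ₜ[ℂ] b)

/-- The operator `A ⊗ 1 + 1 ⊗ B` on the Hilbert space tensor product: the closure of the operator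
`a ⊗ b ↦ A a ⊗ b + a ⊗ B b` defined on the algebraic tensor product of the domains (here through
its graph, the linear span of the pairs `(a ⊗ b, A a ⊗ b + a ⊗ B b)`). -/
def tensorSum (A : E →ₗ.[ℂ] E) (B : F →ₗ.[ℂ] F) : HilbertTensor E F →ₗ.[ℂ] HilbertTensor E F :=
  (Submodule.span ℂ {p : HilbertTensor E F × HilbertTensor E F | ∃ (a : A.domain) (b : B.domain),
    p = (hilbertTmul (a : E) (b : F), hilbertTmul (A a) (b : F) + hilbertTmul (a : E) (B b))}
    ).topologicalClosure.toLinearPMap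

end Tensor

end SmoothMethod

end

/-!
The trace class condition diagonalizes `H_B`. A positive operator of finite trace is compact
(`isCompactOperator_of_summable`), and here it is a function of `H_B`; hence `H_B` has an
orthonormal basis of eigenvectors `eₙ`, with eigenvalues `μₙ` of which only finitely many lie in any
bounded set, and on which `(1 + μₙ²)^(-γ + β/2)` is bounded (`exists_eigenbasis_of_isTraceClassPMap`).

In this basis `H = H_A ⊗ 1 + 1 ⊗ H_B` is the direct sum of the operators `H_A + μₙ`. It is symmetric,
and `H - z` maps onto a dense set, because it acts on `E_A ⊗ eₙ` as `H_A - (z - μₙ)`; so it is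
self-adjoint (`isSelfAdjoint_tensorSum`), and its resolvent is the direct sum of the `R_A(z - μₙ)`.
The vectors `(1 + μₙ²)^(-γ/2) eₙ` form an orthonormal basis of the weighted space, so `R(z)`, as a
form on `X`, is block diagonal with blocks `(1 + μₙ²)^(-γ) R_A(z - μₙ)`
(`isBlockResolvent_tensorSum`), and its norm is at most the supremum of the norms of the blocks
(`norm_le_of_blockDiagonal`). Both assertions are thereby reduced to estimates on `R_A` that are
uniform in `n`.

*Smoothness.* Let `U` be the set of all `l` with `l - μₙ ∈ U_A` for every `n`. Its complement is a
locally finite union of finite sets. Near `l ∈ U`, all but finitely many of the shifted points lie in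
the region where the Hölder estimate on `R_A` is uniform, and the remaining ones are handled by local
Hölder continuity (`IsBlockResolvent.exists_isHolderNear`). Estimates in the open half plane
suffice: by completeness of `𝔅(X, X*)` they produce the boundary values, and they persist for them
(`isSmoothOn_of_isHolderNear`). Away from the real axis the resolvent is locally Lipschitz anyway.

*High-energy order.* By Peetre's inequality `(1 + (l - μ)²)^(-β/2)` is at most a constant times
`(1 + μ²)^(β/2) |l|^(-β)`, and the first factor is absorbed by the weight `(1 + μ²)^(-γ)`
(`IsBlockResolvent.isOfHighEnergyOrderOn`).

The Gelfand triple property of the tensor product comes down to the injectivity of `J_A ⊗ J_B` on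
the completion, which holds because its adjoint has dense range.
-/

noncomputable section

namespace SmoothMethod

open Filter Topology Complex
open scoped NNReal TensorProduct InnerProductSpace LinearPMap

/-! ### A criterion for self-adjointness -/

section Criterion

variable {E : Type*} [NormedAddCommGroup E] [InnerProductSpace ℂ E]

/-- The estimate behind `norm_le_of_isSelfAdjoint`, for operators that are merely symmetric. -/
theorem norm_le_of_symmetric {T : E →ₗ.[ℂ] E}
    (hsymm : ∀ x y : T.domain, ⟪T x, (y : E)⟫_ℂ = ⟪(x : E), T y⟫_ℂ) (z : ℂ) (x : T.domain) :
    |z.im| * ‖(x : E)‖ ≤ ‖T x - z • (x : E)‖ := by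
  have hreal : (⟪(x : E), T x⟫_ℂ).im = 0 := by
    have h2 := congrArg Complex.im (hsymm x x)
    rw [← inner_conj_symm, Complex.conj_im] at h2
    linarith
  have h3 : (⟪(x : E), T x - z • (x : E)⟫_ℂ).im = -(z.im * ‖(x : E)‖ ^ 2) := by
    rw [inner_sub_right, inner_smul_right, inner_self_eq_norm_sq_to_K, Complex.sub_im, hreal]
    have : ((‖(x : E)‖ : ℂ) ^ 2) = ((‖(x : E)‖ ^ 2 : ℝ) : ℂ) := by push_cast; rfl
    change (0 : ℝ) - (z * (‖(x : E)‖ : ℂ) ^ 2).im = _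
    rw [this, Complex.im_mul_ofReal]
    ring
  have h4 : |z.im| * ‖(x : E)‖ ^ 2 ≤ ‖(x : E)‖ * ‖T x - z • (x : E)‖ := by
    calc |z.im| * ‖(x : E)‖ ^ 2 = |(⟪(x : E), T x - z • (x : E)⟫_ℂ).im| := by
          rw [h3, abs_neg, abs_mul, abs_of_nonneg (sq_nonneg ‖(x : E)‖)]
      _ ≤ ‖⟪(x : E), T x - z • (x : E)⟫_ℂ‖ := Complex.abs_im_le_norm _
      _ ≤ _ := norm_inner_le_norm _ _
  rcases (norm_nonneg (x : E)).eq_or_lt with h0 | h0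
  · rw [← h0, mul_zero]; exact norm_nonneg _
  · nlinarith

variable [CompleteSpace E]

/-- For a closed symmetric operator and non-real `z` the range of `T - z` is closed, so it is the
whole space as soon as it is dense. -/
theorem surjective_sub_of_dense_range {T : E →ₗ.[ℂ] E} (hclosed : T.IsClosed)
    (hsymm : ∀ x y : T.domain, ⟪T x, (y : E)⟫_ℂ = ⟪(x : E), T y⟫_ℂ) {z : ℂ} (hz : z.im ≠ 0)
    (hrange : DenseRange fun x : T.domain => T x - z • (x : E)) :
    Function.Surjective fun x : T.domain => T x - z • (x : E) := by
  intro g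
  have hpos : 0 < |z.im| := abs_pos.mpr hz
  obtain ⟨u, hu, hlim⟩ := mem_closure_iff_seq_limit.mp (hrange g)
  choose x hx using hu
  have hlim' : Tendsto (fun k => T (x k) - z • (x k : E)) atTop (𝓝 g) := by
    simpa only [hx] using hlim
  have hc : CauchySeq fun k => (x k : E) := by
    rw [Metric.cauchySeq_iff']
    intro ε hε
    obtain ⟨N, hN⟩ := Metric.cauchySeq_iff'.mp hlim'.cauchySeq (|z.im| * ε) (by positivity)
    refine ⟨N, fun n hn => ?_⟩
    have h1 := norm_le_of_symmetric hsymm z (x n - x N)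
    have h2 := hN n hn
    rw [dist_eq_norm] at h2 ⊢
    have h3 : T (x n - x N) - z • ((x n - x N : T.domain) : E)
        = (T (x n) - z • (x n : E)) - (T (x N) - z • (x N : E)) := by
      rw [LinearPMap.map_sub, Submodule.coe_sub, smul_sub]; abel
    rw [h3] at h1
    exact lt_of_mul_lt_mul_left (h1.trans_lt h2) hpos.le
  obtain ⟨y, hy⟩ := cauchySeq_tendsto_of_complete hc
  have hT : Tendsto (fun k => T (x k)) atTop (𝓝 (g + z • y)) := by
    simpa using hlim'.add (hy.const_smul z)
  have hmem : (y, g + z • y) ∈ T.graph :=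
    IsClosed.mem_of_tendsto hclosed (hy.prodMk_nhds hT)
      (Eventually.of_forall fun k => T.mem_graph _)
  obtain ⟨y', h1, h2⟩ := (LinearPMap.mem_graph_iff T).mp hmem
  refine ⟨y', ?_⟩
  simp only at h1 h2 ⊢
  rw [h1, h2, add_sub_cancel_right]

/-- A densely defined closed symmetric operator `T` is self-adjoint as soon as `T - z` has dense
range for non-real `z`. -/
theorem isSelfAdjoint_of_dense_range {T : E →ₗ.[ℂ] E} (hdense : Dense (T.domain : Set E))
    (hclosed : T.IsClosed)
    (hsymm : ∀ x y : T.domain, ⟪T x, (y : E)⟫_ℂ = ⟪(x : E), T y⟫_ℂ)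
    (hrange : ∀ z : ℂ, z.im ≠ 0 → DenseRange fun x : T.domain => T x - z • (x : E)) :
    IsSelfAdjoint T := by
  have hle : T ≤ T† := LinearPMap.IsFormalAdjoint.le_adjoint hdense fun x y => hsymm x y
  have hadj := LinearPMap.adjoint_isFormalAdjoint hdense
  rw [LinearPMap.isSelfAdjoint_def]
  refine (LinearPMap.eq_of_le_of_domain_eq hle (le_antisymm hle.1 fun x hx => ?_)).symm
  obtain ⟨y, hy⟩ := surjective_sub_of_dense_range hclosed hsymm (z := I) (by simp)
    (hrange I (by simp)) (T† ⟨x, hx⟩ - I • x)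
  simp only at hy
  -- `x - y` lies in the kernel of `T† - i`, that is, in the orthogonal complement of the range of
  -- `T + i`
  have key : x - y = 0 := by
    refine (hrange (-I) (by simp)).eq_zero_of_inner_left ℂ ?_
    intro w
    have h1 : ⟪T† ⟨x, hx⟩, (w : E)⟫_ℂ = ⟪x, T w⟫_ℂ := hadj ⟨x, hx⟩ w
    have h2 := hsymm y w
    have h3 : ⟪T y - I • (y : E), (w : E)⟫_ℂ = ⟪T† ⟨x, hx⟩ - I • x, (w : E)⟫_ℂ := by rw [hy]
    simp only [inner_sub_left, inner_smul_left, inner_sub_right, inner_smul_right] at h3 ⊢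
    rw [h1, h2] at h3
    simp only [conj_I] at h3
    linear_combination -h3
  rw [sub_eq_zero.mp key]
  exact y.2

/-- The first resolvent identity. -/
theorem opResolvent_sub {T : E →ₗ.[ℂ] E} (hT : IsSelfAdjoint T) {z z' : ℂ} (hz : z.im ≠ 0)
    (hz' : z'.im ≠ 0) :
    opResolvent T z - opResolvent T z' = (z - z') • (opResolvent T z * opResolvent T z') := by
  have h := isResolventAt_opResolvent hT hz
  have h' := isResolventAt_opResolvent hT hz'
  ext y
  have e1 := h.left_inv (⟨_, h.mem_domain y⟩ - ⟨_, h'.mem_domain y⟩ : T.domain)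
  have e2 : T (⟨_, h.mem_domain y⟩ - ⟨_, h'.mem_domain y⟩ : T.domain)
      - z • ((⟨_, h.mem_domain y⟩ - ⟨_, h'.mem_domain y⟩ : T.domain) : E)
      = (z - z') • opResolvent T z' y := by
    have a1 := h.right_inv y
    have a2 := h'.right_inv y
    rw [LinearPMap.map_sub, Submodule.coe_sub, smul_sub]
    rw [sub_eq_iff_eq_add] at a1 a2
    rw [a1, a2]
    module
  rw [e2, map_smul] at e1
  exact e1.symm

theorem commute_opResolvent {T : E →ₗ.[ℂ] E} (hT : IsSelfAdjoint T) {z z' : ℂ} (hz : z.im ≠ 0)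
    (hz' : z'.im ≠ 0) : Commute (opResolvent T z) (opResolvent T z') := by
  rcases eq_or_ne z z' with rfl | hne
  · exact Commute.refl _
  have h1 := opResolvent_sub hT hz hz'
  have h2 := opResolvent_sub hT hz' hz
  rw [← neg_sub, h2, ← neg_smul, neg_sub] at h1
  exact (smul_right_injective _ (sub_ne_zero.mpr hne) h1).symm

theorem norm_opResolvent_le {T : E →ₗ.[ℂ] E} (hT : IsSelfAdjoint T) {z : ℂ} {r : ℝ} (hr : 0 < r)
    (hz : r ≤ |z.im|) : ‖opResolvent T z‖ ≤ 1 / r := by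
  have h := isResolventAt_opResolvent hT (abs_pos.mp (hr.trans_le hz))
  refine ContinuousLinearMap.opNorm_le_bound _ (by positivity) fun y => ?_
  have e := norm_le_of_isSelfAdjoint hT z ⟨_, h.mem_domain y⟩
  rw [h.right_inv y] at e
  rw [div_mul_eq_mul_div, one_mul, le_div_iff₀ hr, mul_comm]
  exact (mul_le_mul_of_nonneg_right hz (norm_nonneg _)).trans e

theorem norm_opResolvent_sub_le {T : E →ₗ.[ℂ] E} (hT : IsSelfAdjoint T) {z z' : ℂ} {r : ℝ}
    (hr : 0 < r) (hz : r ≤ |z.im|) (hz' : r ≤ |z'.im|) :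
    ‖opResolvent T z - opResolvent T z'‖ ≤ 1 / r * (1 / r) * ‖z - z'‖ := by
  rw [opResolvent_sub hT (abs_pos.mp (hr.trans_le hz)) (abs_pos.mp (hr.trans_le hz')), norm_smul,
    mul_comm]
  have h1 := norm_opResolvent_le hT hr hz
  have h2 := norm_opResolvent_le hT hr hz'
  gcongr
  exact (norm_mul_le _ _).trans (by gcongr)

theorem commute_invOneAddSq_rpow {T : E →ₗ.[ℂ] E} (hT : IsSelfAdjoint T) (q : ℝ) :
    Commute ((invOneAddSq T) ^ q : E →L[ℂ] E) (opResolvent T I) := by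
  have h : Commute (invOneAddSq T) (opResolvent T I) :=
    (commute_opResolvent hT (by simp) (by simp)).mul_left (Commute.refl _)
  rw [CFC.rpow_def]
  exact h.cfc_nnreal _

end Criterion

/-! ### Eigenvectors of unbounded operators -/

section Eigen

variable {E : Type*} [NormedAddCommGroup E] [InnerProductSpace ℂ E]

/-- `T v = μ v` with `v` in the domain of `T` and `μ` real; `v = 0` is allowed. -/
def IsEigenpair (T : E →ₗ.[ℂ] E) (μ : ℝ) (v : E) : Prop :=
  ∃ h : v ∈ T.domain, T ⟨v, h⟩ = (μ : ℂ) • v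

variable [CompleteSpace E]

theorem ofReal_sub_ne_zero {z : ℂ} (hz : z.im ≠ 0) (μ : ℝ) : (μ : ℂ) - z ≠ 0 := fun h => by
  have := congrArg Complex.im h
  simp at this
  exact hz this

theorem IsEigenpair.opResolvent_apply {T : E →ₗ.[ℂ] E} (hT : IsSelfAdjoint T) {μ : ℝ} {v : E}
    (h : IsEigenpair T μ v) {z : ℂ} (hz : z.im ≠ 0) :
    opResolvent T z v = ((μ : ℂ) - z)⁻¹ • v := by
  obtain ⟨hv, h⟩ := h
  have h1 := (isResolventAt_opResolvent hT hz).left_inv ⟨v, hv⟩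
  rw [h, ← sub_smul, map_smul] at h1
  exact (eq_inv_smul_iff₀ (ofReal_sub_ne_zero hz μ)).mpr h1

/-- Eigenvectors of the resolvent are eigenvectors of the operator, and the eigenvalue is real. -/
theorem isEigenpair_of_opResolvent {T : E →ₗ.[ℂ] E} (hT : IsSelfAdjoint T) {ρ : ℂ} {v : E}
    (hv : v ≠ 0) (h : opResolvent T I v = ρ • v) : ∃ μ : ℝ, IsEigenpair T μ v := by
  have hR := isResolventAt_opResolvent hT (z := I) (by simp)
  have hρ : ρ ≠ 0 := by
    rintro rfl
    rw [zero_smul] at h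
    exact hv (opResolvent_injective hT (z := I) (by simp) (by rw [h, map_zero]))
  have hdom : v ∈ T.domain := by
    have := T.domain.smul_mem ρ⁻¹ (hR.mem_domain v)
    rwa [h, smul_smul, inv_mul_cancel₀ hρ, one_smul] at this
  have h1 := hR.right_inv v
  have h2 : (⟨opResolvent T I v, hR.mem_domain v⟩ : T.domain) = ρ • ⟨v, hdom⟩ := Subtype.ext h
  rw [h2, LinearPMap.map_smul, h] at h1
  have h3 : T ⟨v, hdom⟩ = (ρ⁻¹ + I) • v := by
    have h4 : ρ • T ⟨v, hdom⟩ = (1 + ρ * I) • v := by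
      rw [sub_eq_iff_eq_add] at h1
      rw [h1]; module
    calc T ⟨v, hdom⟩ = ρ⁻¹ • (ρ • T ⟨v, hdom⟩) := by
          rw [smul_smul, inv_mul_cancel₀ hρ, one_smul]
      _ = _ := by
        rw [h4, smul_smul]; congr 1; field_simp
  have h5 := inner_symm_of_isSelfAdjoint hT ⟨v, hdom⟩ ⟨v, hdom⟩
  rw [h3] at h5
  simp only [inner_smul_left, inner_smul_right] at h5
  have h6 := mul_right_cancel₀ (inner_self_ne_zero.mpr hv) h5
  obtain ⟨μ, hμ⟩ := Complex.conj_eq_iff_real.mp h6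
  exact ⟨μ, hdom, by rw [h3, hμ]⟩

theorem IsEigenpair.invOneAddSq_apply {T : E →ₗ.[ℂ] E} (hT : IsSelfAdjoint T) {μ : ℝ} {v : E}
    (h : IsEigenpair T μ v) : invOneAddSq T v = (((1 + μ ^ 2)⁻¹ : ℝ) : ℂ) • v := by
  rw [invOneAddSq, mul_apply_eq_comp, h.opResolvent_apply hT (by simp), map_smul,
    h.opResolvent_apply hT (by simp), smul_smul, ← mul_inv]
  congr 1
  push_cast
  congr 1
  linear_combination -I_sq

/-- The continuous functional calculus acts on an eigenvector by evaluation at the eigenvalue. -/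
theorem cfc_apply_of_apply_eq_smul {a : E →L[ℂ] E} (ha : IsSelfAdjoint a) {d : ℝ} {v : E}
    (hv : a v = (d : ℂ) • v) {f : ℝ → ℝ} (hf : Continuous f) :
    cfc f a v = (f d : ℂ) • v := by
  have hpoly : ∀ p : Polynomial ℝ, cfc p.eval a v = ((p.eval d : ℝ) : ℂ) • v := by
    intro p
    rw [cfc_polynomial p a ha]
    induction p using Polynomial.induction_on' with
    | add p q hp hq => simp only [map_add, add_apply, hp, hq,
        Polynomial.eval_add, ofReal_add, add_smul]
    | monomial n c =>
      have hpow : ∀ n : ℕ, (a ^ n) v = ((d ^ n : ℝ) : ℂ) • v := by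
        intro n
        induction n with
        | zero => simp
        | succ n ih =>
          rw [pow_succ, mul_apply_eq_comp, hv, map_smul, ih, smul_smul]
          congr 1; push_cast; ring
      rw [Polynomial.aeval_monomial, Polynomial.eval_monomial, mul_apply_eq_comp, hpow]
      simp only [Algebra.algebraMap_eq_smul_one, map_smul, smul_apply, one_apply_eq_self]
      rw [← Complex.coe_smul c v, smul_smul, mul_comm]
      push_cast
      rfl
  -- on `[-M, M]`, which contains the spectrum and `d`, approximate `f` by polynomials
  set M := max (‖a‖ * ‖(1 : E →L[ℂ] E)‖) |d|
  rw [← sub_eq_zero, ← norm_le_zero_iff]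
  refine le_of_forall_pos_le_add fun ε hε => ?_
  obtain ⟨p, hp⟩ := exists_polynomial_near_of_continuousOn (-M) M f hf.continuousOn
    (ε / (2 * (‖v‖ + 1))) (by positivity)
  set η := ε / (2 * (‖v‖ + 1)) with hη
  have hη0 : 0 < η := by positivity
  have h1 : ‖cfc f a - cfc p.eval a‖ ≤ η := by
    rw [← cfc_sub f p.eval a hf.continuousOn p.continuous.continuousOn]
    refine norm_cfc_le hη0.le fun x hx => ?_
    have hx' : |x| ≤ M := (spectrum.norm_le_norm_mul_of_mem hx).trans (le_max_left _ _)
    have := hp x (abs_le.mp hx')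
    rw [Real.norm_eq_abs, abs_sub_comm]
    exact this.le
  have h2 : ‖(((p.eval d : ℝ) : ℂ) - (f d : ℂ)) • v‖ ≤ η * ‖v‖ := by
    rw [norm_smul, ← ofReal_sub, norm_real]
    gcongr
    exact (hp d (abs_le.mp (le_max_right _ _))).le
  have h3 : cfc f a v - (f d : ℂ) • v
      = (cfc f a - cfc p.eval a) v + (((p.eval d : ℝ) : ℂ) - (f d : ℂ)) • v := by
    rw [sub_apply, hpoly, sub_smul]; abel
  rw [h3, zero_add]
  calc _ ≤ η * ‖v‖ + η * ‖v‖ := (norm_add_le _ _).trans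
        (add_le_add ((ContinuousLinearMap.le_opNorm _ _).trans (by gcongr)) h2)
    _ = η * (2 * ‖v‖) := by ring
    _ ≤ η * (2 * (‖v‖ + 1)) := by gcongr; linarith
    _ = ε := by rw [hη]; field_simp

theorem IsEigenpair.invOneAddSq_rpow_apply {T : E →ₗ.[ℂ] E} (hT : IsSelfAdjoint T) {μ : ℝ} {v : E}
    (h : IsEigenpair T μ v) {q : ℝ} (hq : 0 ≤ q) :
    ((invOneAddSq T) ^ q : E →L[ℂ] E) v = (((1 + μ ^ 2) ^ (-q) : ℝ) : ℂ) • v := by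
  have h0 := invOneAddSq_nonneg hT
  rw [CFC.rpow_eq_cfc_real h0, cfc_apply_of_apply_eq_smul (IsSelfAdjoint.of_nonneg h0)
    (h.invOneAddSq_apply hT) (Real.continuous_rpow_const hq), Real.inv_rpow (by positivity),
    Real.rpow_neg (by positivity)]

end Eigen

/-! ### Positive operators of finite trace -/

section Trace

variable {E : Type*} [NormedAddCommGroup E] [InnerProductSpace ℂ E]

theorem hasSum_norm_inner_sq {ι : Type*} (e : HilbertBasis ι ℂ E) (y : E) :
    HasSum (fun i => ‖⟪e i, y⟫_ℂ‖ ^ 2) (‖y‖ ^ 2) := by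
  have h := (e.hasSum_inner_mul_inner y y).mapL Complex.reCLM
  have h1 : ∀ i, Complex.reCLM (⟪y, e i⟫_ℂ * ⟪e i, y⟫_ℂ) = ‖⟪e i, y⟫_ℂ‖ ^ 2 := fun i => by
    rw [← inner_conj_symm y (e i), Complex.conj_mul']
    simp [← ofReal_pow]
  simp only [h1] at h
  rw [inner_self_eq_norm_sq_to_K] at h
  convert h
  simp [← ofReal_pow]

variable [CompleteSpace E]

theorem sqrt_inner_comm {S : E →L[ℂ] E} (x y : E) :
    ⟪CFC.sqrt S x, y⟫_ℂ = ⟪x, CFC.sqrt S y⟫_ℂ := by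
  have h := IsSelfAdjoint.of_nonneg (CFC.sqrt_nonneg S)
  rw [← ContinuousLinearMap.adjoint_inner_left, ← ContinuousLinearMap.star_eq_adjoint, h.star_eq]

theorem re_inner_eq_norm_sqrt_sq {S : E →L[ℂ] E} (hS : 0 ≤ S) (x : E) :
    (⟪x, S x⟫_ℂ).re = ‖CFC.sqrt S x‖ ^ 2 := by
  conv_lhs => rw [← CFC.sqrt_mul_sqrt_self S hS]
  rw [mul_apply_eq_comp, ← sqrt_inner_comm]
  exact inner_self_eq_norm_sq (𝕜 := ℂ) _

/-- A positive operator of finite trace is compact: its square root is a norm limit of finite rank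
operators. -/
theorem isCompactOperator_of_summable {S : E →L[ℂ] E} (hS : 0 ≤ S) {ι : Type*}
    (e : HilbertBasis ι ℂ E) (hsum : Summable fun i => (⟪e i, S (e i)⟫_ℂ).re) :
    IsCompactOperator S := by
  set T := CFC.sqrt S with hT
  have hTc : IsCompactOperator T := by
    have hcl := isClosed_setOfPred_isCompactOperator (σ₁₂ := RingHom.id ℂ) (M₁ := E) (M₂ := E)
    refine hcl.closure_subset (Metric.mem_closure_iff.mpr fun ε hε => ?_)
    simp only [re_inner_eq_norm_sqrt_sq hS, ← hT] at hsum
    obtain ⟨F, hF⟩ := summable_iff_vanishing_norm.mp hsum ((ε / 2) ^ 2) (by positivity)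
    -- `K` is `T` followed by the projection onto the span of the `e i` with `i ∈ F`
    let K : E →L[ℂ] E := ∑ i ∈ F, (innerSL ℂ (T (e i))).smulRight (e i)
    have hK : IsCompactOperator K := by
      refine (compactOperator (RingHom.id ℂ) E E).sum_mem fun i _ => ?_
      exact ((isCompactOperator_id (E := ℂ)).comp_clm (innerSL ℂ (T (e i)))).clm_comp
        (ContinuousLinearMap.toSpanSingleton ℂ (e i))
    refine ⟨K, hK, ?_⟩
    rw [dist_eq_norm]
    refine (ContinuousLinearMap.opNorm_le_bound _ (half_pos hε).le fun x => ?_).trans_lt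
      (half_lt_self hε)
    classical
    have hcoef : ∀ i, ⟪e i, (T - K) x⟫_ℂ = if i ∈ F then 0 else ⟪T (e i), x⟫_ℂ := by
      intro i
      rw [sub_apply, inner_sub_right, ← sqrt_inner_comm]
      have : K x = ∑ j ∈ F, ⟪T (e j), x⟫_ℂ • e j := by
        simp [K]
      rw [this, inner_sum]
      simp only [inner_smul_right, orthonormal_iff_ite.mp e.orthonormal]
      split_ifs with h <;> simp [h, hT]
    have h := hasSum_norm_inner_sq e ((T - K) x)
    refine abs_le_of_sq_le_sq' ?_ (by positivity) |>.2
    refine hasSum_le_of_sum_le h fun G => ?_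
    have h1 := hF (G \ F) Finset.sdiff_disjoint
    rw [Real.norm_eq_abs, abs_of_nonneg (Finset.sum_nonneg fun _ _ => sq_nonneg _)] at h1
    calc ∑ i ∈ G, ‖⟪e i, (T - K) x⟫_ℂ‖ ^ 2
        = ∑ i ∈ G \ F, ‖⟪T (e i), x⟫_ℂ‖ ^ 2 := by
          rw [Finset.sdiff_eq_filter, Finset.sum_filter]
          refine Finset.sum_congr rfl fun i _ => ?_
          rw [hcoef]
          split_ifs <;> simp
      _ ≤ ∑ i ∈ G \ F, ‖T (e i)‖ ^ 2 * ‖x‖ ^ 2 := by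
          refine Finset.sum_le_sum fun i _ => ?_
          rw [← mul_pow]
          gcongr
          exact norm_inner_le_norm _ _
      _ ≤ (ε / 2 * ‖x‖) ^ 2 := by
          rw [← Finset.sum_mul, mul_pow]
          gcongr
  have : (S : E → E) = T ∘ T := by
    conv_lhs => rw [← CFC.sqrt_mul_sqrt_self S hS]
    rfl
  rw [this]
  exact hTc.comp_clm T

/-- Bessel's inequality for the trace: an orthonormal family picks up at most the full trace. -/
theorem sum_inner_le_of_orthonormal {S : E →L[ℂ] E} (hS : 0 ≤ S) {ι κ : Type*}
    (e : HilbertBasis ι ℂ E) (hsum : Summable fun i => (⟪e i, S (e i)⟫_ℂ).re) {v : κ → E}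
    (hv : Orthonormal ℂ v) (s : Finset κ) :
    ∑ k ∈ s, (⟪v k, S (v k)⟫_ℂ).re ≤ ∑' i, (⟪e i, S (e i)⟫_ℂ).re := by
  simp only [re_inner_eq_norm_sqrt_sq hS] at hsum ⊢
  refine hasSum_le (fun i => ?_)
    (hasSum_sum fun k (_ : k ∈ s) => hasSum_norm_inner_sq e (CFC.sqrt S (v k))) hsum.hasSum
  have h := hv.sum_inner_products_le (CFC.sqrt S (e i)) (s := s)
  refine le_trans (le_of_eq (Finset.sum_congr rfl fun k _ => ?_)) h
  rw [← sqrt_inner_comm, norm_inner_symm]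

/-- Only finitely many eigenvalues, with multiplicity, of a positive operator of finite trace are at
least a given positive number. -/
theorem finite_of_le_eigenvalue {S : E →L[ℂ] E} (hS : 0 ≤ S) {ι κ : Type*}
    (e : HilbertBasis ι ℂ E) (hsum : Summable fun i => (⟪e i, S (e i)⟫_ℂ).re) {v : κ → E}
    (hv : Orthonormal ℂ v) {d : κ → ℝ} (hd : ∀ k, S (v k) = (d k : ℂ) • v k) {ε : ℝ}
    (hε : 0 < ε) : {k | ε ≤ d k}.Finite := by
  by_contra hinf
  obtain ⟨n, hn⟩ := exists_nat_gt ((∑' i, (⟪e i, S (e i)⟫_ℂ).re) / ε)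
  obtain ⟨s, hs, rfl⟩ := Set.Infinite.exists_subset_card_eq hinf n
  have h := sum_inner_le_of_orthonormal hS e hsum hv s
  have h1 : ∀ k, (⟪v k, S (v k)⟫_ℂ).re = d k := fun k => by
    rw [hd, inner_smul_right, inner_self_eq_norm_sq_to_K, hv.1 k]; simp
  simp only [h1] at h
  have h2 : (s.card : ℝ) * ε ≤ ∑ k ∈ s, d k := by
    rw [← nsmul_eq_mul]
    exact Finset.card_nsmul_le_sum _ _ _ fun k hk => hs hk
  rw [div_lt_iff₀ hε] at hn
  linarith

end Trace

/-! ### Diagonalization -/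

section Diagonal

theorem apply_eq_of_eq_toPMap {E : Type*} [NormedAddCommGroup E] [InnerProductSpace ℂ E]
    {f : E →ₗ.[ℂ] E} {S : E →L[ℂ] E} (h : f = S.toPMap ⊤) (x : f.domain) : f x = S x := by
  subst h; rfl

variable {E : Type*} [NormedAddCommGroup E] [InnerProductSpace ℂ E] [CompleteSpace E]

/-- A self-adjoint operator whose resolvent commutes with an injective compact symmetric operator
`S` has an orthonormal basis of eigenvectors: a maximal orthonormal set of joint eigenvectors of `T`
and `S` is one, because `S` has a finite dimensional eigenspace in the orthogonal complement, on
which the resolvent acts. -/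
theorem exists_hilbertBasis_isEigenpair {T : E →ₗ.[ℂ] E} (hT : IsSelfAdjoint T) {S : E →L[ℂ] E}
    (hS : 0 ≤ S) (hSc : IsCompactOperator S) (hSi : Function.Injective S)
    (hcomm : Commute S (opResolvent T I)) :
    ∃ (w : Set E) (e : HilbertBasis w ℂ E) (μ : w → ℝ), ∀ n, IsEigenpair T (μ n) (e n) := by
  set R := opResolvent T I with hR
  have hsym : ∀ x y, ⟪S x, y⟫_ℂ = ⟪x, S y⟫_ℂ := fun x y => by
    rw [← ContinuousLinearMap.adjoint_inner_left, ← ContinuousLinearMap.star_eq_adjoint,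
      (IsSelfAdjoint.of_nonneg hS).star_eq]
  let P : Set E → Prop := fun w => Orthonormal ℂ ((↑) : w → E) ∧
    ∀ v ∈ w, (∃ μ : ℝ, IsEigenpair T μ v) ∧ ∃ ν : ℂ, S v = ν • v
  obtain ⟨w, hw⟩ : ∃ w, Maximal P w := by
    refine zorn_subset {w | P w} fun c hc hchain =>
      ⟨⋃₀ c, ⟨?_, ?_⟩, fun s => Set.subset_sUnion_of_mem⟩
    · exact orthonormal_sUnion_of_directed hchain.directedOn fun s hs => (hc hs).1
    · rintro v ⟨s, hs, hv⟩
      exact (hc hs).2 v hv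
  set W : Submodule ℂ E := (Submodule.span ℂ w)ᗮ with hWdef
  have hW : ∀ {x}, x ∈ W ↔ ∀ v ∈ w, ⟪v, x⟫_ℂ = 0 := by
    intro x
    rw [hWdef, Submodule.mem_orthogonal]
    refine ⟨fun h v hv => h v (Submodule.subset_span hv), fun h u hu => ?_⟩
    induction hu using Submodule.span_induction with
    | mem v hv => exact h v hv
    | zero => simp
    | add x y _ _ hx hy => rw [inner_add_left, hx, hy, add_zero]
    | smul a x _ hx => rw [inner_smul_left, hx, mul_zero]
  have hWS : ∀ x ∈ W, S x ∈ W := fun x hx => hW.mpr fun v hv => by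
    obtain ⟨ν, hν⟩ := (hw.1.2 v hv).2
    rw [← hsym, hν, inner_smul_left, hW.mp hx v hv, mul_zero]
  have hWR : ∀ x ∈ W, R x ∈ W := fun x hx => hW.mpr fun v hv => by
    obtain ⟨μ, hμ⟩ := (hw.1.2 v hv).1
    rw [← ContinuousLinearMap.adjoint_inner_left, ← ContinuousLinearMap.star_eq_adjoint, hR,
      adjoint_opResolvent hT, hμ.opResolvent_apply hT (by simp), inner_smul_left, hW.mp hx v hv,
      mul_zero]
  have hbot : W = ⊥ := by
    by_contra hne
    -- a nonzero eigenvalue of `S` on `W`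
    let S' : W →L[ℂ] W := S.restrict hWS
    have hS'c : IsCompactOperator S' := hSc.restrict' hWS
    have hS's : S'.IsSymmetric := fun x y => hsym x y
    obtain ⟨x₀, hx₀W, hx₀⟩ := Submodule.exists_mem_ne_zero_of_ne_bot hne
    have hS'0 : S' ≠ 0 := fun h => hx₀ (hSi (by
      have := congrArg (fun A : W →L[ℂ] W => (A ⟨x₀, hx₀W⟩ : E)) h
      rw [map_zero]; exact this))
    obtain ⟨ν, hν, hν0⟩ : ∃ ν, Module.End.HasEigenvalue (S' : Module.End ℂ W) ν ∧ ν ≠ 0 := by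
      by_contra hcon
      push Not at hcon
      exact hS'0 ((ContinuousLinearMap.eq_zero_of_forall_hasEigenvalue_eq_zero hS'c hS's).mp hcon)
    -- the corresponding finite dimensional eigenspace, on which the resolvent acts
    let V : Submodule ℂ E := W ⊓ Module.End.eigenspace (S : Module.End ℂ E) ν
    have hVfin : FiniteDimensional ℂ V := by
      have := ContinuousLinearMap.finite_dimensional_eigenspace hSc ν hν0
      exact Submodule.finiteDimensional_of_le inf_le_right
    obtain ⟨y, hy⟩ := hν.exists_hasEigenvector
    have hyV : (y : E) ∈ V := Submodule.mem_inf.mpr ⟨y.2, Module.End.mem_eigenspace_iff.mpr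
      (congrArg Subtype.val (Module.End.mem_eigenspace_iff.mp hy.1))⟩
    have hnt : Nontrivial V := ⟨⟨⟨y, hyV⟩, 0, fun h => hy.2 (Subtype.ext
      (congrArg (Subtype.val : V → E) h))⟩⟩
    have hVR : ∀ x ∈ V, R x ∈ V := fun x hx => Submodule.mem_inf.mpr ⟨hWR x hx.1, by
      have h1 : S x = ν • x := Module.End.mem_eigenspace_iff.mp hx.2
      refine Module.End.mem_eigenspace_iff.mpr ?_
      change (S * R) x = ν • R x
      rw [hcomm.eq, mul_apply_eq_comp, h1, map_smul]⟩
    obtain ⟨ρ, hρ⟩ := Module.End.exists_eigenvalue ((R : E →ₗ[ℂ] E).restrict hVR)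
    obtain ⟨v, hv⟩ := hρ.exists_hasEigenvector
    have hv0 : (v : E) ≠ 0 := fun h => hv.2 (Subtype.ext h)
    have hRv : R v = ρ • (v : E) := congrArg Subtype.val (Module.End.mem_eigenspace_iff.mp hv.1)
    obtain ⟨μ, hμ⟩ := isEigenpair_of_opResolvent hT hv0 hRv
    have hSv : S v = ν • (v : E) := Module.End.mem_eigenspace_iff.mp v.2.2
    -- the normalized joint eigenvector `u` contradicts the maximality of `w`
    set u : E := ((‖(v : E)‖⁻¹ : ℝ) : ℂ) • (v : E) with hu
    have hu1 : ‖u‖ = 1 := by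
      rw [hu, norm_smul, norm_real, norm_inv, norm_norm, inv_mul_cancel₀ (norm_ne_zero_iff.mpr hv0)]
    have huW : u ∈ W := W.smul_mem _ v.2.1
    have hins : P (insert u w) := by
      refine ⟨?_, ?_⟩
      · classical
        rw [orthonormal_subtype_iff_ite]
        have ho := orthonormal_subtype_iff_ite.mp hw.1.1
        have huw : ∀ x ∈ w, ⟪x, u⟫_ℂ = 0 ∧ ⟪u, x⟫_ℂ = 0 ∧ x ≠ u := fun x hx => by
          have h0 := hW.mp huW x hx
          refine ⟨h0, inner_eq_zero_symm.mp h0, ?_⟩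
          rintro rfl
          rw [inner_self_eq_zero] at h0
          rw [h0, norm_zero] at hu1
          exact zero_ne_one hu1
        rintro a (rfl | ha) b (rfl | hb)
        · simp [inner_self_eq_norm_sq_to_K, hu1]
        · rw [(huw b hb).2.1, if_neg (huw b hb).2.2.symm]
        · rw [(huw a ha).1, if_neg (huw a ha).2.2]
        · exact ho a ha b hb
      · rintro x (rfl | hx)
        · refine ⟨⟨μ, ?_⟩, ν, ?_⟩
          · obtain ⟨hdom, hTv⟩ := hμ
            refine ⟨T.domain.smul_mem _ hdom, ?_⟩
            have : (⟨u, T.domain.smul_mem _ hdom⟩ : T.domain)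
                = ((‖(v : E)‖⁻¹ : ℝ) : ℂ) • ⟨v, hdom⟩ := rfl
            rw [this, LinearPMap.map_smul, hTv, smul_comm]
          · rw [hu, map_smul, hSv, smul_comm]
        · exact hw.1.2 x hx
    have huw : u ∈ w := hw.2 hins (Set.subset_insert u w) (Set.mem_insert u w)
    have h0 := hW.mp huW u huw
    rw [inner_self_eq_zero] at h0
    rw [h0, norm_zero] at hu1
    exact zero_ne_one hu1
  have hsp : (Submodule.span ℂ (Set.range ((↑) : w → E)))ᗮ = ⊥ := by
    rw [Subtype.range_coe]; exact hbot
  choose μ hμ using fun n : w => (hw.1.2 n n.2).1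
  refine ⟨w, HilbertBasis.mkOfOrthogonalEqBot hw.1.1 hsp, μ, fun n => ?_⟩
  rw [HilbertBasis.coe_mkOfOrthogonalEqBot]
  exact hμ n

/-- If `(1 + T²)^p` is of trace class, the operator that represents it is positive and injective,
commutes with the resolvent, and acts on eigenvectors of `T` as expected. -/
theorem properties_of_oneAddSqPow_eq_toPMap {T : E →ₗ.[ℂ] E} (hT : IsSelfAdjoint T) {p : ℝ}
    {S : E →L[ℂ] E} (h : oneAddSqPow T p = S.toPMap ⊤) :
    0 ≤ S ∧ Function.Injective S ∧ Commute S (opResolvent T I) ∧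
      ∀ (μ : ℝ) (v : E), IsEigenpair T μ v → S v = (((1 + μ ^ 2) ^ p : ℝ) : ℂ) • v := by
  rcases le_or_gt p 0 with hp | hp
  · have hS : S = (invOneAddSq T) ^ (-p) := by
      have h1 : ((invOneAddSq T) ^ (-p)).toPMap ⊤ = S.toPMap ⊤ := (if_pos hp).symm.trans h
      ext x
      exact (apply_eq_of_eq_toPMap h1 ⟨x, trivial⟩).symm
    subst hS
    refine ⟨CFC.rpow_nonneg, invOneAddSq_rpow_injective hT (neg_nonneg.mpr hp),
      commute_invOneAddSq_rpow hT _, fun μ v hv => ?_⟩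
    rw [hv.invOneAddSq_rpow_apply hT (neg_nonneg.mpr hp), neg_neg]
  -- for `p > 0` the operator `S` is a two-sided inverse of the bounded operator `(1 + T²)^(-p)`, so
  -- that `E` is finite dimensional; the argument does not need this
  · set B : E →L[ℂ] E := (invOneAddSq T) ^ p with hB
    have hB0 : 0 ≤ B := CFC.rpow_nonneg
    have hdom : (oneAddSqPow T p).domain = ⊤ := by rw [h]; rfl
    have h1 : B * S = 1 := by
      ext x
      have h2 := invOneAddSq_rpow_oneAddSqPow hT hp ⟨x, by rw [hdom]; trivial⟩
      rw [apply_eq_of_eq_toPMap h] at h2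
      exact h2
    have h2 : S * B = 1 := by
      ext x
      refine invOneAddSq_rpow_injective hT hp.le ?_
      change (B * S) (B x) = B x
      rw [h1]; rfl
    have hstar : star S = S := by
      have h3 : star S * B = 1 := by
        have := congrArg star h1
        rwa [star_mul, star_one, (IsSelfAdjoint.of_nonneg hB0).star_eq] at this
      calc star S = star S * (B * S) := by rw [h1, mul_one]
        _ = S := by rw [← mul_assoc, h3, one_mul]
    refine ⟨?_, ?_, ?_, fun μ v hv => ?_⟩
    · have h3 := star_left_conjugate_nonneg hB0 S
      rwa [hstar, h2, one_mul] at h3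
    · intro x y hxy
      have h3 := congrArg B hxy
      change (B * S) x = (B * S) y at h3
      rwa [h1] at h3
    · have hc : B * opResolvent T I = opResolvent T I * B := commute_invOneAddSq_rpow hT p
      calc S * opResolvent T I = S * opResolvent T I * (B * S) := by rw [h1, mul_one]
        _ = S * (opResolvent T I * B) * S := by simp only [mul_assoc]
        _ = (S * B) * opResolvent T I * S := by rw [← hc]; simp only [mul_assoc]
        _ = _ := by rw [h2, one_mul]
    · have h3 : S (B v) = v := congrArg (fun A : E →L[ℂ] E => A v) h2
      have hpos : (0 : ℝ) < 1 + μ ^ 2 := by positivity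
      rw [hB, hv.invOneAddSq_rpow_apply hT hp.le, map_smul] at h3
      conv_rhs => rw [← h3]
      rw [smul_smul, ← ofReal_mul, ← Real.rpow_add hpos, add_neg_cancel, Real.rpow_zero, ofReal_one,
        one_smul]

/-- If `(1 + T²)^p` is of trace class, then `T` has an orthonormal basis of eigenvectors, its
eigenvalues (with multiplicity) do not accumulate, and `(1 + μ²)^p` is bounded on them. -/
theorem exists_eigenbasis_of_isTraceClassPMap {T : E →ₗ.[ℂ] E} (hT : IsSelfAdjoint T) {p : ℝ}
    (h : IsTraceClassPMap (oneAddSqPow T p)) :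
    ∃ (w : Set E) (e : HilbertBasis w ℂ E) (μ : w → ℝ), (∀ n, IsEigenpair T (μ n) (e n)) ∧
      (∀ K, {n | |μ n| ≤ K}.Finite) ∧ ∃ C, ∀ n, (1 + μ n ^ 2) ^ p ≤ C := by
  obtain ⟨S, hS, w₀, e₀, hsum⟩ := h
  obtain ⟨hS0, hSi, hcomm, hev⟩ := properties_of_oneAddSqPow_eq_toPMap hT hS
  rw [CFC.abs_of_nonneg S hS0] at hsum
  obtain ⟨w, e, μ, hμ⟩ := exists_hilbertBasis_isEigenpair hT hS0
    (isCompactOperator_of_summable hS0 e₀ hsum) hSi hcomm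
  refine ⟨w, e, μ, hμ, fun K => ?_, ‖S‖, fun n => ?_⟩
  -- on `|μ| ≤ K` the function `(1 + μ²)^p` is bounded below, by `(1 + K²)^p` or by `1` according to
  -- the sign of `p`
  · have hpos : 0 < min 1 ((1 + K ^ 2) ^ p) := lt_min one_pos (by positivity)
    refine (finite_of_le_eigenvalue hS0 e₀ hsum e.orthonormal (fun n => hev _ _ (hμ n))
      hpos).subset fun n hn => ?_
    have h1 : μ n ^ 2 ≤ K ^ 2 := sq_le_sq' (abs_le.mp hn).1 (abs_le.mp hn).2
    rcases le_or_gt p 0 with hp | hp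
    · exact (min_le_right _ _).trans
        (Real.rpow_le_rpow_of_nonpos (by positivity) (by linarith) hp)
    · exact (min_le_left _ _).trans
        (Real.one_le_rpow (by linarith [sq_nonneg (μ n)]) hp.le)
  · have h1 := S.le_opNorm (e n)
    rw [hev _ _ (hμ n), norm_smul, e.orthonormal.1 n, mul_one, mul_one, norm_real,
      Real.norm_of_nonneg (by positivity)] at h1
    exact h1

end Diagonal

/-! ### Block decompositions -/

section BlockDecomposition

variable {ι E X : Type*} [NormedAddCommGroup E] [InnerProductSpace ℂ E]
  [NormedAddCommGroup X] [InnerProductSpace ℂ X]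

/-- The map `(xₙ) ↦ ∑ τₙ xₙ` on finitely supported families. -/
def blockSum (τ : ι → E →ₗ[ℂ] X) : (ι →₀ E) →ₗ[ℂ] X :=
  Finsupp.lsum ℂ τ

theorem blockSum_apply (τ : ι → E →ₗ[ℂ] X) (x : ι →₀ E) :
    blockSum τ x = ∑ n ∈ x.support, τ n (x n) := rfl

/-- The maps `τₙ` identify a dense subspace of `X` with the algebraic direct sum of copies of `E`,
with its Hilbert sum norm. -/
structure IsBlockDecomposition (τ : ι → E →ₗ[ℂ] X) : Prop where
  norm_sq : ∀ x : ι →₀ E, ‖blockSum τ x‖ ^ 2 = ∑ n ∈ x.support, ‖x n‖ ^ 2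
  denseRange : DenseRange (blockSum τ)

variable {τ : ι → E →ₗ[ℂ] X}

/-- The norm of a form that is block diagonal with respect to a block decomposition is at most the
supremum of the norms of its blocks. -/
theorem norm_le_of_blockDiagonal (hτ : IsBlockDecomposition τ) {B : X →L[ℂ] (X →L⋆[ℂ] ℂ)}
    {b : ι → E →L[ℂ] (E →L⋆[ℂ] ℂ)} {M : ℝ} (hM : 0 ≤ M) (hb : ∀ n, ‖b n‖ ≤ M)
    (hdiag : ∀ n x y, B (τ n x) (τ n y) = b n x y)
    (hoff : ∀ n m x y, n ≠ m → B (τ n x) (τ m y) = 0) :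
    ‖B‖ ≤ M := by
  classical
  have key : ∀ x y : ι →₀ E, ‖B (blockSum τ x) (blockSum τ y)‖
      ≤ M * ‖blockSum τ x‖ * ‖blockSum τ y‖ := by
    intro x y
    have h1 : B (blockSum τ x) (blockSum τ y) = ∑ n ∈ x.support ∩ y.support, b n (x n) (y n) := by
      rw [blockSum_apply, map_sum, sum_apply]
      rw [← Finset.sum_subset (Finset.inter_subset_left (s₁ := x.support) (s₂ := y.support))]
      · refine Finset.sum_congr rfl fun n hn => ?_
        rw [blockSum_apply, map_sum, Finset.sum_eq_single n, hdiag]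
        · exact fun m _ hm => hoff _ _ _ _ hm.symm
        · exact fun h => absurd (Finset.mem_inter.mp hn).2 h
      · intro n hn hn'
        rw [blockSum_apply, map_sum]
        refine Finset.sum_eq_zero fun m hm => hoff _ _ _ _ ?_
        rintro rfl
        exact hn' (Finset.mem_inter.mpr ⟨hn, hm⟩)
    have h2 : ∀ x : ι →₀ E, ∀ s ⊆ x.support, √(∑ n ∈ s, ‖x n‖ ^ 2) ≤ ‖blockSum τ x‖ := by
      intro x s hs
      rw [Real.sqrt_le_left (norm_nonneg _), hτ.norm_sq]
      exact Finset.sum_le_sum_of_subset_of_nonneg hs fun _ _ _ => sq_nonneg _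
    calc ‖B (blockSum τ x) (blockSum τ y)‖
        ≤ ∑ n ∈ x.support ∩ y.support, M * (‖x n‖ * ‖y n‖) := by
          rw [h1]
          refine norm_sum_le_of_le _ fun n _ => ?_
          rw [← mul_assoc]
          exact ((b n).le_opNorm₂ _ _).trans (by gcongr; exact hb n)
      _ ≤ M * (√(∑ n ∈ x.support ∩ y.support, ‖x n‖ ^ 2)
            * √(∑ n ∈ x.support ∩ y.support, ‖y n‖ ^ 2)) := by
          rw [← Finset.mul_sum]
          gcongr
          exact Real.sum_mul_le_sqrt_mul_sqrt _ _ _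
      _ ≤ M * (‖blockSum τ x‖ * ‖blockSum τ y‖) := by
          gcongr
          · exact h2 x _ Finset.inter_subset_left
          · exact h2 y _ Finset.inter_subset_right
      _ = _ := by ring
  refine ContinuousLinearMap.opNorm_le_bound₂ _ hM fun x y => ?_
  refine hτ.denseRange.induction_on y (isClosed_le (by fun_prop) (by fun_prop)) fun y => ?_
  refine hτ.denseRange.induction_on x (isClosed_le ?_ (by fun_prop)) fun x => key x y
  exact ((continuous_eval_const (F := X →L⋆[ℂ] ℂ) (blockSum τ y)).comp B.continuous).norm

end BlockDecomposition

/-! ### The Hilbert space tensor product -/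

section Tensor

variable {E F : Type*} [NormedAddCommGroup E] [InnerProductSpace ℂ E]
  [NormedAddCommGroup F] [InnerProductSpace ℂ F]

/-- The bounded bilinear map `(a, b) ↦ a ⊗ b`. -/
def hilbertTmulL (E F : Type*) [NormedAddCommGroup E] [InnerProductSpace ℂ E]
    [NormedAddCommGroup F] [InnerProductSpace ℂ F] : E →L[ℂ] F →L[ℂ] HilbertTensor E F :=
  ((ContinuousLinearMap.compL ℂ F (E ⊗[ℂ] F) (HilbertTensor E F))
    UniformSpace.Completion.toComplL).comp (TensorProduct.mkL ℂ E F)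

theorem hilbertTmulL_apply (a : E) (b : F) : hilbertTmulL E F a b = hilbertTmul a b := rfl

theorem hilbertTmul_smul_right (c : ℂ) (a : E) (b : F) :
    hilbertTmul a (c • b) = c • hilbertTmul a b := by
  simp only [← hilbertTmulL_apply, map_smul]

theorem inner_hilbertTmul (a a' : E) (b b' : F) :
    ⟪hilbertTmul a b, hilbertTmul a' b'⟫_ℂ = ⟪a, a'⟫_ℂ * ⟪b, b'⟫_ℂ :=
  (UniformSpace.Completion.inner_coe _ _).trans (TensorProduct.inner_tmul ..)

theorem hilbertTensorMap_hilbertTmul {E' F' : Type*} [NormedAddCommGroup E']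
    [InnerProductSpace ℂ E'] [NormedAddCommGroup F'] [InnerProductSpace ℂ F']
    (S₁ : E →L[ℂ] E') (S₂ : F →L[ℂ] F') (a : E) (b : F) :
    hilbertTensorMap S₁ S₂ (hilbertTmul a b) = hilbertTmul (S₁ a) (S₂ b) :=
  ContinuousLinearMap.completion_apply_coe _ _

/-- Elementary tensors with factors from total sets are total. -/
theorem eq_top_of_hilbertTmul_mem {M : Submodule ℂ (HilbertTensor E F)}
    (hM : IsClosed (M : Set (HilbertTensor E F))) {A : Set E} {B : Set F}
    (hA : Dense (Submodule.span ℂ A : Set E)) (hB : Dense (Submodule.span ℂ B : Set F))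
    (h : ∀ a ∈ A, ∀ b ∈ B, hilbertTmul a b ∈ M) : M = ⊤ := by
  have h1 : ∀ a, ∀ b ∈ B, hilbertTmul a b ∈ M := fun a b hb => by
    have hcl : IsClosed ((hilbertTmulL E F).flip b ⁻¹' M) := hM.preimage (by fun_prop)
    exact closure_minimal (Submodule.span_le (p := M.comap
      ((hilbertTmulL E F).flip b : E →ₗ[ℂ] HilbertTensor E F)).mpr fun a ha => h a ha b hb)
      hcl (hA a)
  have h2 : ∀ a b, hilbertTmul a b ∈ M := fun a b => by
    have hcl : IsClosed (hilbertTmulL E F a ⁻¹' M) := hM.preimage (by fun_prop)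
    exact closure_minimal (Submodule.span_le (p := M.comap
      (hilbertTmulL E F a : F →ₗ[ℂ] HilbertTensor E F)).mpr fun b hb => h1 a b hb)
      hcl (hB b)
  rw [eq_top_iff]
  rintro x -
  induction x using UniformSpace.Completion.induction_on with
  | hp => exact hM
  | ih t =>
    induction t using TensorProduct.induction_on with
    | zero => exact M.zero_mem
    | tmul a b => exact h2 a b
    | add s t hs ht =>
      rw [UniformSpace.Completion.coe_add]
      exact M.add_mem hs ht

theorem dense_span_univ : Dense (Submodule.span ℂ (Set.univ : Set E) : Set E) := by
  simp

theorem dense_span_range_hilbertBasis {ι : Type*} (e : HilbertBasis ι ℂ F) :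
    Dense (Submodule.span ℂ (Set.range e) : Set F) :=
  Submodule.dense_iff_topologicalClosure_eq_top.mpr e.dense_span

section Blocks

variable {ι : Type*} (e : HilbertBasis ι ℂ F)

/-- An orthonormal basis `eₙ` of `F` decomposes `E ⊗ F` into the orthogonal blocks `E ⊗ eₙ`. -/
theorem isBlockDecomposition_hilbertTensor : IsBlockDecomposition fun n =>
    ((hilbertTmulL E F).flip (e n) : E →ₗ[ℂ] HilbertTensor E F) where
  norm_sq x := by
    classical
    have h : ⟪blockSum (fun n =>
        ((hilbertTmulL E F).flip (e n) : E →ₗ[ℂ] HilbertTensor E F)) x, blockSum (fun n =>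
        ((hilbertTmulL E F).flip (e n) : E →ₗ[ℂ] HilbertTensor E F)) x⟫_ℂ
          = ∑ n ∈ x.support, ⟪x n, x n⟫_ℂ := by
      rw [blockSum_apply, sum_inner]
      refine Finset.sum_congr rfl fun n hn => ?_
      rw [inner_sum, Finset.sum_eq_single n]
      · refine (inner_hilbertTmul _ _ _ _).trans ?_
        rw [inner_self_eq_norm_sq_to_K (e n), e.orthonormal.1]; simp
      · intro m _ hm
        refine (inner_hilbertTmul _ _ _ _).trans ?_
        rw [e.orthonormal.2 hm.symm, mul_zero]
      · exact fun h => absurd hn h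
    rw [← inner_self_eq_norm_sq (𝕜 := ℂ), h, map_sum]
    exact Finset.sum_congr rfl fun n _ => inner_self_eq_norm_sq (𝕜 := ℂ) _
  denseRange := by
    have h := eq_top_of_hilbertTmul_mem
      (M := (LinearMap.range (blockSum fun n =>
        ((hilbertTmulL E F).flip (e n) : E →ₗ[ℂ] HilbertTensor E F))).topologicalClosure)
      (Submodule.isClosed_topologicalClosure _) dense_span_univ
      (dense_span_range_hilbertBasis e) ?_
    · have := Submodule.dense_iff_topologicalClosure_eq_top.mpr h
      rwa [LinearMap.coe_range] at this
    · rintro a - _ ⟨n, rfl⟩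
      refine Submodule.le_topologicalClosure _ ⟨Finsupp.single n a, ?_⟩
      exact Finsupp.lsum_single _ _ _ _

end Blocks

end Tensor

/-! ### Gelfand triples -/

section Gelfand

theorem denseRange_adjoint {X H : Type*} [NormedAddCommGroup X] [InnerProductSpace ℂ X]
    [CompleteSpace X] [NormedAddCommGroup H] [InnerProductSpace ℂ H] [CompleteSpace H]
    {J : X →L[ℂ] H} (hJ : Function.Injective J) : DenseRange J.adjoint := by
  have h := ContinuousLinearMap.orthogonal_range J.adjoint
  rw [ContinuousLinearMap.adjoint_adjoint, LinearMap.ker_eq_bot.mpr hJ] at h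
  have h1 := (Submodule.topologicalClosure_eq_top_iff).mpr h
  have h2 := Submodule.dense_iff_topologicalClosure_eq_top.mpr h1
  rwa [LinearMap.coe_range] at h2

/-- For Hilbert spaces the dense range of `H → X*` is a consequence of the injectivity of
`X → H`. -/
theorem isGelfandTriple_of_injective {X H : Type*} [NormedAddCommGroup X] [InnerProductSpace ℂ X]
    [CompleteSpace X] [NormedAddCommGroup H] [InnerProductSpace ℂ H] [CompleteSpace H]
    {J : X →L[ℂ] H} (hJ : Function.Injective J) (hd : DenseRange J) : IsGelfandTriple J := by
  refine ⟨hJ, hd, ?_⟩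
  have h1 : (toConjDual J : H → X →L⋆[ℂ] ℂ)
      = toConjDual (ContinuousLinearMap.id ℂ X) ∘ J.adjoint := by
    funext φ
    ext ψ
    simp [ContinuousLinearMap.adjoint_inner_right]
  have h2 : Function.Surjective (toConjDual (ContinuousLinearMap.id ℂ X)) := by
    intro l
    let l' : X →L[ℂ] ℂ := (starL ℂ : ℂ ≃L⋆[ℂ] ℂ).toContinuousLinearMap.comp l
    refine ⟨(InnerProductSpace.toDual ℂ X).symm l', ?_⟩
    ext ψ
    have h3 : ⟪(InnerProductSpace.toDual ℂ X).symm l', ψ⟫_ℂ = star (l ψ) := by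
      rw [InnerProductSpace.toDual_symm_apply]; rfl
    rw [toConjDual_apply, ContinuousLinearMap.id_apply, ← inner_conj_symm, h3]
    exact star_star _
  rw [h1]
  exact h2.denseRange.comp (denseRange_adjoint hJ) (ContinuousLinearMap.continuous _)

variable {XA EA XB EB : Type*}
  [NormedAddCommGroup XA] [InnerProductSpace ℂ XA] [CompleteSpace XA]
  [NormedAddCommGroup EA] [InnerProductSpace ℂ EA] [CompleteSpace EA]
  [NormedAddCommGroup XB] [InnerProductSpace ℂ XB] [CompleteSpace XB]
  [NormedAddCommGroup EB] [InnerProductSpace ℂ EB] [CompleteSpace EB]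

theorem dense_span_range_of_denseRange {X H : Type*} [NormedAddCommGroup H]
    [InnerProductSpace ℂ H] {f : X → H} (hf : DenseRange f) :
    Dense (Submodule.span ℂ (Set.range f) : Set H) :=
  hf.mono Submodule.subset_span

/-- The only point that is not immediate is injectivity: a vector in the kernel of `J_A ⊗ J_B` is
orthogonal to the vectors `J_A† a ⊗ J_B† b`, which are total. -/
theorem isGelfandTriple_hilbertTensorMap {JA : XA →L[ℂ] EA} {JB : XB →L[ℂ] EB}
    (hA : Function.Injective JA) (hA' : DenseRange JA) (hB : Function.Injective JB)
    (hB' : DenseRange JB) : IsGelfandTriple (hilbertTensorMap JA JB) := by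
  refine isGelfandTriple_of_injective ?_ ?_
  · rw [injective_iff_map_eq_zero]
    intro ψ hψ
    have hadj : ∀ a b, ⟪hilbertTmul (JA.adjoint a) (JB.adjoint b), ψ⟫_ℂ = 0 := by
      intro a b
      let f := innerSL ℂ (hilbertTmul (JA.adjoint a) (JB.adjoint b))
        - (innerSL ℂ (hilbertTmul a b)).comp (hilbertTensorMap JA JB)
      have h : LinearMap.ker (f : HilbertTensor XA XB →ₗ[ℂ] ℂ) = ⊤ := by
        refine eq_top_of_hilbertTmul_mem f.isClosed_ker dense_span_univ dense_span_univ ?_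
        intro x _ y _
        rw [LinearMap.mem_ker]
        simp [f, hilbertTensorMap_hilbertTmul, inner_hilbertTmul,
          ContinuousLinearMap.adjoint_inner_left]
      have h1 : f ψ = 0 := LinearMap.mem_ker.mp (h ▸ Submodule.mem_top)
      have h2 : f ψ = ⟪hilbertTmul (JA.adjoint a) (JB.adjoint b), ψ⟫_ℂ
        - ⟪hilbertTmul a b, hilbertTensorMap JA JB ψ⟫_ℂ := rfl
      rwa [h2, hψ, inner_zero_right, sub_zero] at h1
    have h : LinearMap.ker (innerSL ℂ ψ : HilbertTensor XA XB →ₗ[ℂ] ℂ) = ⊤ := by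
      refine eq_top_of_hilbertTmul_mem (innerSL ℂ ψ).isClosed_ker
        (dense_span_range_of_denseRange (denseRange_adjoint hA))
        (dense_span_range_of_denseRange (denseRange_adjoint hB)) ?_
      rintro _ ⟨a, rfl⟩ _ ⟨b, rfl⟩
      exact LinearMap.mem_ker.mpr (inner_eq_zero_symm.mp (hadj a b))
    have h1 : ψ ∈ LinearMap.ker (innerSL ℂ ψ : HilbertTensor XA XB →ₗ[ℂ] ℂ) :=
      h ▸ Submodule.mem_top
    exact inner_self_eq_zero.mp (LinearMap.mem_ker.mp h1)
  · have h := eq_top_of_hilbertTmul_mem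
      (M := (LinearMap.range (hilbertTensorMap JA JB).toLinearMap).topologicalClosure)
      (Submodule.isClosed_topologicalClosure _) (dense_span_range_of_denseRange hA')
      (dense_span_range_of_denseRange hB') ?_
    · have := Submodule.dense_iff_topologicalClosure_eq_top.mpr h
      rwa [LinearMap.coe_range] at this
    · rintro _ ⟨a, rfl⟩ _ ⟨b, rfl⟩
      exact Submodule.le_topologicalClosure _
        ⟨hilbertTmul a b, hilbertTensorMap_hilbertTmul JA JB a b⟩

end Gelfand

/-! ### The operator `A ⊗ 1 + 1 ⊗ B` -/

section TensorSum

variable {E F : Type*} [NormedAddCommGroup E] [InnerProductSpace ℂ E] [CompleteSpace E]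
  [NormedAddCommGroup F] [InnerProductSpace ℂ F] [CompleteSpace F]

/-- A relation that is symmetric on a set of pairs is symmetric on its closed linear span. -/
theorem inner_eq_of_mem_topologicalClosure_span {H : Type*} [NormedAddCommGroup H]
    [InnerProductSpace ℂ H] {s : Set (H × H)}
    (hs : ∀ p ∈ s, ∀ q ∈ s, ⟪q.1, p.2⟫_ℂ = ⟪q.2, p.1⟫_ℂ) {p q : H × H}
    (hp : p ∈ (Submodule.span ℂ s).topologicalClosure)
    (hq : q ∈ (Submodule.span ℂ s).topologicalClosure) : ⟪q.1, p.2⟫_ℂ = ⟪q.2, p.1⟫_ℂ := by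
  let l : H × H → H × H →L[ℂ] ℂ := fun q =>
    (innerSL ℂ q.1).comp (ContinuousLinearMap.snd ℂ H H)
      - (innerSL ℂ q.2).comp (ContinuousLinearMap.fst ℂ H H)
  have hl : ∀ q p, l q p = ⟪q.1, p.2⟫_ℂ - ⟪q.2, p.1⟫_ℂ := fun _ _ => rfl
  have aux : ∀ q, (∀ p ∈ s, l q p = 0) → ∀ p ∈ (Submodule.span ℂ s).topologicalClosure,
      l q p = 0 := by
    intro q h p hp
    exact (Submodule.topologicalClosure_minimal _ (Submodule.span_le.mpr fun p hp =>
      LinearMap.mem_ker.mpr (h p hp)) (l q).isClosed_ker) hp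
  have hflip : ∀ p q, l q p = 0 → l p q = 0 := by
    intro p q h
    rw [hl, sub_eq_zero] at h ⊢
    rw [← inner_conj_symm, ← h, inner_conj_symm]
  have h := aux p (fun q hq => hflip p q (aux q (fun p hp => by
    rw [hl, hs p hp q hq, sub_self]) p hp)) q hq
  exact sub_eq_zero.mp ((hl q p).symm.trans (hflip q p h))

/-- The generating pairs of the graph of `A ⊗ 1 + 1 ⊗ B`. -/
def tensorSumPairs (A : E →ₗ.[ℂ] E) (B : F →ₗ.[ℂ] F) :
    Set (HilbertTensor E F × HilbertTensor E F) :=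
  {p | ∃ (a : A.domain) (b : B.domain),
    p = (hilbertTmul (a : E) (b : F), hilbertTmul (A a) (b : F) + hilbertTmul (a : E) (B b))}

variable {A : E →ₗ.[ℂ] E} {B : F →ₗ.[ℂ] F}

theorem inner_eq_of_mem_tensorSumPairs (hA : IsSelfAdjoint A) (hB : IsSelfAdjoint B)
    {p q : HilbertTensor E F × HilbertTensor E F}
    (hp : p ∈ (Submodule.span ℂ (tensorSumPairs A B)).topologicalClosure)
    (hq : q ∈ (Submodule.span ℂ (tensorSumPairs A B)).topologicalClosure) :
    ⟪q.1, p.2⟫_ℂ = ⟪q.2, p.1⟫_ℂ := by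
  refine inner_eq_of_mem_topologicalClosure_span ?_ hp hq
  rintro _ ⟨a, b, rfl⟩ _ ⟨a', b', rfl⟩
  simp only [inner_add_left, inner_add_right, inner_hilbertTmul]
  rw [inner_symm_of_isSelfAdjoint hA, inner_symm_of_isSelfAdjoint hB]

theorem dense_span_fst_tensorSumPairs (hA : IsSelfAdjoint A) (hB : IsSelfAdjoint B) :
    Dense ((Submodule.span ℂ (tensorSumPairs A B)).topologicalClosure.map
      (LinearMap.fst ℂ _ _) : Set (HilbertTensor E F)) := by
  rw [Submodule.dense_iff_topologicalClosure_eq_top]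
  refine eq_top_of_hilbertTmul_mem (Submodule.isClosed_topologicalClosure _)
    (A := A.domain) (B := B.domain) ?_ ?_ fun a ha b hb => ?_
  · rw [Submodule.span_eq]; exact hA.dense_domain
  · rw [Submodule.span_eq]; exact hB.dense_domain
  · exact Submodule.le_topologicalClosure _ ⟨_, Submodule.le_topologicalClosure _
      (Submodule.subset_span ⟨⟨a, ha⟩, ⟨b, hb⟩, rfl⟩), rfl⟩

/-- The closed span that defines `tensorSum` is the graph of an operator, so that the junk value of
`Submodule.toLinearPMap` does not occur: `A ⊗ 1 + 1 ⊗ B` is closable, being symmetric. -/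
theorem graph_tensorSum (hA : IsSelfAdjoint A) (hB : IsSelfAdjoint B) :
    (tensorSum A B).graph = (Submodule.span ℂ (tensorSumPairs A B)).topologicalClosure := by
  refine Submodule.toLinearPMap_graph_eq _ fun p hp hp0 => ?_
  refine (dense_span_fst_tensorSumPairs hA hB).eq_zero_of_inner_right ℂ ?_
  rintro _ ⟨q, hq, rfl⟩
  have h := inner_eq_of_mem_tensorSumPairs hA hB hp hq
  rw [hp0, inner_zero_right] at h
  exact h

theorem tensorSum_symm (hA : IsSelfAdjoint A) (hB : IsSelfAdjoint B)
    (x y : (tensorSum A B).domain) :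
    ⟪tensorSum A B x, (y : HilbertTensor E F)⟫_ℂ
      = ⟪(x : HilbertTensor E F), tensorSum A B y⟫_ℂ := by
  have hx := (tensorSum A B).mem_graph x
  have hy := (tensorSum A B).mem_graph y
  rw [graph_tensorSum hA hB] at hx hy
  exact (inner_eq_of_mem_tensorSumPairs hA hB hy hx).symm

/-- On `E ⊗ v`, with `v` an eigenvector of `B`, the operator acts as `(A + μ) ⊗ 1`; so the equation
`(A ⊗ 1 + 1 ⊗ B - z) x = y ⊗ v` is solved by means of the resolvent of `A` at `z - μ`. -/
theorem tensorSum_sub_hilbertTmul (hA : IsSelfAdjoint A) (hB : IsSelfAdjoint B) {μ : ℝ} {v : F}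
    (hv : IsEigenpair B μ v) {z : ℂ} (hz : z.im ≠ 0) (y : E) :
    ∃ x : (tensorSum A B).domain,
      (x : HilbertTensor E F) = hilbertTmul (opResolvent A (z - μ) y) v ∧
      tensorSum A B x - z • (x : HilbertTensor E F) = hilbertTmul y v := by
  obtain ⟨hvd, hBv⟩ := hv
  have hR := isResolventAt_opResolvent hA (z := z - μ) (by simpa using hz)
  set u : A.domain := ⟨opResolvent A (z - μ) y, hR.mem_domain y⟩ with hu
  have hg : (hilbertTmul (u : E) v, hilbertTmul (A u) v + hilbertTmul (u : E) (B ⟨v, hvd⟩))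
      ∈ (tensorSum A B).graph := by
    rw [graph_tensorSum hA hB]
    exact Submodule.le_topologicalClosure _ (Submodule.subset_span ⟨u, ⟨v, hvd⟩, rfl⟩)
  obtain ⟨x, hx, hTx⟩ := (LinearPMap.mem_graph_iff _).mp hg
  refine ⟨x, hx, ?_⟩
  have hAu : A u = y + (z - μ) • (u : E) := sub_eq_iff_eq_add.mp (hR.right_inv y)
  simp only at hx hTx
  rw [hTx, hx, hBv, hAu]
  simp only [← hilbertTmulL_apply, map_add, map_smul, add_apply, smul_apply]
  module

/-- `A ⊗ 1 + 1 ⊗ B` is self-adjoint if `B` has an orthonormal basis of eigenvectors. -/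
theorem isSelfAdjoint_tensorSum (hA : IsSelfAdjoint A) (hB : IsSelfAdjoint B) {ι : Type*}
    (e : HilbertBasis ι ℂ F) {μ : ι → ℝ} (he : ∀ n, IsEigenpair B (μ n) (e n)) :
    IsSelfAdjoint (tensorSum A B) := by
  refine isSelfAdjoint_of_dense_range (dense_span_fst_tensorSumPairs hA hB) ?_
    (tensorSum_symm hA hB) fun z hz => ?_
  · rw [LinearPMap.IsClosed, graph_tensorSum hA hB]
    exact Submodule.isClosed_topologicalClosure _
  · let f : (tensorSum A B).domain →ₗ[ℂ] HilbertTensor E F :=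
      (tensorSum A B).toFun - z • (tensorSum A B).domain.subtype
    have h := eq_top_of_hilbertTmul_mem (M := (LinearMap.range f).topologicalClosure)
      (Submodule.isClosed_topologicalClosure _) dense_span_univ
      (dense_span_range_hilbertBasis e) ?_
    · have := Submodule.dense_iff_topologicalClosure_eq_top.mpr h
      rwa [LinearMap.coe_range] at this
    · rintro y - _ ⟨n, rfl⟩
      obtain ⟨x, -, hx⟩ := tensorSum_sub_hilbertTmul hA hB (he n) hz y
      exact Submodule.le_topologicalClosure _ ⟨x, hx⟩

theorem opResolvent_tensorSum_hilbertTmul (hA : IsSelfAdjoint A) (hB : IsSelfAdjoint B)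
    (hT : IsSelfAdjoint (tensorSum A B)) {μ : ℝ} {v : F} (hv : IsEigenpair B μ v) {z : ℂ}
    (hz : z.im ≠ 0) (y : E) :
    opResolvent (tensorSum A B) z (hilbertTmul y v)
      = hilbertTmul (opResolvent A (z - μ) y) v := by
  obtain ⟨x, hx, hTx⟩ := tensorSum_sub_hilbertTmul hA hB hv hz y
  rw [← hTx, (isResolventAt_opResolvent hT hz).left_inv, hx]

end TensorSum

/-! ### The weighted space -/

section Weighted

variable {E : Type*} [NormedAddCommGroup E] [InnerProductSpace ℂ E] [CompleteSpace E]
  {T : E →ₗ.[ℂ] E} (hT : IsSelfAdjoint T) {γ : ℝ}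

theorem weight_surjective (hγ : 0 < γ) : Function.Surjective (WeightedSpace.weight T hT γ) := by
  have hW : oneAddSqPow T (γ / 2) = (((invOneAddSq T) ^ (γ / 2)).toPMap ⊤).inverse :=
    if_neg (not_le.mpr (half_pos hγ))
  have hker : LinearMap.ker ((((invOneAddSq T) ^ (γ / 2)).toPMap ⊤).toFun) = ⊥ := by
    refine LinearMap.ker_eq_bot.mpr fun a b hab => Subtype.ext ?_
    exact invOneAddSq_rpow_injective hT (half_pos hγ).le hab
  have h := LinearPMap.inverse_range hker
  rw [← hW] at h
  exact LinearMap.range_eq_top.mp h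

variable (hγ : 0 < γ)

/-- The weight `(1 + T²)^(γ/2)` is unitary from the weighted space onto `E`. -/
def weightEquiv : WeightedSpace T hT γ ≃ₗᵢ[ℂ] E :=
  LinearIsometryEquiv.ofSurjective
    ⟨WeightedSpace.weight T hT γ, fun x => (WeightedSpace.norm_def T hT γ x).symm⟩
    (weight_surjective hT hγ)

theorem incl_apply (x : WeightedSpace T hT γ) :
    WeightedSpace.incl T hT hγ x = ((invOneAddSq T) ^ (γ / 2) : E →L[ℂ] E) (weightEquiv hT hγ x) :=
  (invOneAddSq_rpow_oneAddSqPow hT (half_pos hγ) x).symm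

theorem completeSpace_weightedSpace (hγ : 0 < γ) : CompleteSpace (WeightedSpace T hT γ) :=
  ((weightEquiv hT hγ).toIsometryEquiv.completeSpace_iff).mpr inferInstance

theorem incl_injective : Function.Injective (WeightedSpace.incl T hT hγ) :=
  fun _ _ h => Subtype.ext h

theorem denseRange_incl : DenseRange (WeightedSpace.incl T hT hγ) := by
  have h0 : (0 : E →L[ℂ] E) ≤ (invOneAddSq T) ^ (γ / 2) := CFC.rpow_nonneg
  have h := denseRange_adjoint (invOneAddSq_rpow_injective hT (half_pos hγ).le)
  rw [← ContinuousLinearMap.star_eq_adjoint, (IsSelfAdjoint.of_nonneg h0).star_eq] at h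
  have h1 : (WeightedSpace.incl T hT hγ : WeightedSpace T hT γ → E)
      = ((invOneAddSq T) ^ (γ / 2) : E →L[ℂ] E) ∘ weightEquiv hT hγ :=
    funext (incl_apply hT hγ)
  rw [h1]
  exact h.comp (weightEquiv hT hγ).surjective.denseRange (ContinuousLinearMap.continuous _)

/-- The orthonormal basis `(1 + T²)^(-γ/2) eₙ` of the weighted space. -/
def weightedBasis {ι : Type*} (e : HilbertBasis ι ℂ E) : HilbertBasis ι ℂ (WeightedSpace T hT γ) :=
  HilbertBasis.ofRepr ((weightEquiv hT hγ).trans e.repr)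

theorem incl_weightedBasis {ι : Type*} (e : HilbertBasis ι ℂ E) {μ : ι → ℝ} {n : ι}
    (h : IsEigenpair T (μ n) (e n)) :
    WeightedSpace.incl T hT hγ (weightedBasis hT hγ e n)
      = (((1 + μ n ^ 2) ^ (-(γ / 2)) : ℝ) : ℂ) • e n := by
  classical
  have h1 : weightEquiv hT hγ (weightedBasis hT hγ e n) = e n := by
    rw [← HilbertBasis.repr_symm_single, ← HilbertBasis.repr_symm_single e n]
    simp [weightedBasis]
  rw [incl_apply, h1, h.invOneAddSq_rpow_apply hT (half_pos hγ).le]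

end Weighted

/-! ### Hölder estimates up to the boundary -/

section Boundary

variable {Y : Type*} [NormedAddCommGroup Y]

/-- A Hölder estimate in the part of the disc of radius `r` about `l` that lies in the open half
plane selected by the sign `s`. -/
def IsHolderNear (F : ℂ → Y) (s : ℝ) (l : ℂ) (C θ r : ℝ) : Prop :=
  ∀ z z' : ℂ, 0 < s * z.im → 0 < s * z'.im → ‖z - l‖ < r → ‖z' - l‖ < r →
    ‖F z - F z'‖ ≤ C * ‖z - z'‖ ^ θ

/-- The constants can be weakened. The bound on the radius keeps the points within distance one of
each other, where lowering the exponent weakens the estimate. -/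
theorem IsHolderNear.mono {F : ℂ → Y} {s : ℝ} {l : ℂ} {C θ r C' θ' r' : ℝ}
    (h : IsHolderNear F s l C θ r) (hC0 : 0 ≤ C') (hC : C ≤ C') (hθ0 : 0 < θ') (hθ : θ' ≤ θ)
    (hr : r' ≤ r) (hr1 : r' ≤ 1 / 2) : IsHolderNear F s l C' θ' r' := by
  intro z z' hz hz' hzl hzl'
  have h1 : ‖z - z'‖ ≤ 1 := by
    calc ‖z - z'‖ = ‖(z - l) - (z' - l)‖ := by rw [sub_sub_sub_cancel_right]
      _ ≤ ‖z - l‖ + ‖z' - l‖ := norm_sub_le _ _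
      _ ≤ 1 := by linarith
  refine (h z z' hz hz' (hzl.trans_le hr) (hzl'.trans_le hr)).trans ?_
  refine mul_le_mul hC ?_ (by positivity) hC0
  rcases (norm_nonneg (z - z')).eq_or_lt with h0 | h0
  · rw [← h0, Real.zero_rpow hθ0.ne', Real.zero_rpow (hθ0.trans_le hθ).ne']
  · exact Real.rpow_le_rpow_of_exponent_ge h0 h1 hθ

theorem tendsto_shift (s : ℝ) (z : ℂ) :
    Tendsto (fun ε : ℝ => z + ((s * ε : ℝ) : ℂ) * I) (𝓝[>] 0) (𝓝 z) := by
  have h : Continuous fun ε : ℝ => z + ((s * ε : ℝ) : ℂ) * I := by fun_prop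
  have h1 := h.tendsto 0
  simp only [mul_zero, ofReal_zero, zero_mul, add_zero] at h1
  exact h1.mono_left nhdsWithin_le_nhds

theorem shift_pos {s : ℝ} (hs : s = 1 ∨ s = -1) {z : ℂ} (hz : 0 ≤ s * z.im) {ε : ℝ} (hε : 0 < ε) :
    0 < s * (z + ((s * ε : ℝ) : ℂ) * I).im := by
  have h : s * s = 1 := by rcases hs with rfl | rfl <;> norm_num
  have h1 : (z + ((s * ε : ℝ) : ℂ) * I).im = z.im + s * ε := by simp
  rw [h1, mul_add, ← mul_assoc, h]
  linarith

theorem eventually_shift {s : ℝ} (hs : s = 1 ∨ s = -1) {l z : ℂ} {r : ℝ} (hz : 0 ≤ s * z.im)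
    (hzl : ‖z - l‖ < r) : ∀ᶠ ε : ℝ in 𝓝[>] 0,
      0 < s * (z + ((s * ε : ℝ) : ℂ) * I).im ∧ ‖z + ((s * ε : ℝ) : ℂ) * I - l‖ < r := by
  have h := ((tendsto_shift s z).sub_const l).norm.eventually_lt_const hzl
  filter_upwards [h, self_mem_nhdsWithin] with ε h1 h2 using ⟨shift_pos hs hz h2, h1⟩

/-- A Hölder estimate in the open half plane forces the existence of the boundary values. -/
theorem IsHolderNear.exists_limit [CompleteSpace Y] {F : ℂ → Y} {s : ℝ} (hs : s = 1 ∨ s = -1)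
    {l : ℂ} {C θ r : ℝ} (h : IsHolderNear F s l C θ r) (hθ : 0 < θ) {z : ℂ}
    (hz : 0 ≤ s * z.im) (hzl : ‖z - l‖ < r) :
    ∃ L, Tendsto (fun ε : ℝ => F (z + ((s * ε : ℝ) : ℂ) * I)) (𝓝[>] 0) (𝓝 L) := by
  refine cauchy_map_iff_exists_tendsto.mp (cauchy_map_iff.mpr ⟨inferInstance, ?_⟩)
  rw [tendsto_uniformity_iff_dist_tendsto_zero]
  have hev := eventually_shift hs hz hzl
  have hlim : Tendsto (fun p : ℝ × ℝ => C * ‖(z + ((s * p.1 : ℝ) : ℂ) * I)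
      - (z + ((s * p.2 : ℝ) : ℂ) * I)‖ ^ θ) (𝓝[>] 0 ×ˢ 𝓝[>] 0) (𝓝 0) := by
    have h1 := (((tendsto_shift s z).comp (tendsto_fst (g := 𝓝[>] (0 : ℝ)))).sub
      ((tendsto_shift s z).comp (tendsto_snd (f := 𝓝[>] (0 : ℝ))))).norm
    rw [sub_self, norm_zero] at h1
    have h2 := (h1.rpow_const (p := θ) (Or.inr hθ.le)).const_mul C
    rwa [Real.zero_rpow hθ.ne', mul_zero] at h2
  refine squeeze_zero' (Eventually.of_forall fun _ => dist_nonneg) ?_ hlim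
  filter_upwards [hev.prod_mk hev] with p hp
  rw [dist_eq_norm]
  exact h _ _ hp.1.1 hp.2.1 hp.1.2 hp.2.2

/-- Extension of `F` to the real axis by its boundary values from the half plane selected by the
sign `s`; only meaningful where the limit exists. -/
def boundaryExt (F : ℂ → Y) (s : ℝ) (z : ℂ) : Y :=
  if z.im = 0 then limUnder (𝓝[>] (0 : ℝ)) fun ε => F (z + ((s * ε : ℝ) : ℂ) * I) else F z

theorem IsHolderNear.tendsto_boundaryExt [CompleteSpace Y] {F : ℂ → Y} {s : ℝ}
    (hs : s = 1 ∨ s = -1) {l : ℂ} {C θ r : ℝ} (h : IsHolderNear F s l C θ r) (hθ : 0 < θ) {z : ℂ}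
    (hz : 0 < s * z.im ∨ z.im = 0) (hzl : ‖z - l‖ < r) :
    Tendsto (fun ε : ℝ => F (z + ((s * ε : ℝ) : ℂ) * I)) (𝓝[>] 0) (𝓝 (boundaryExt F s z)) := by
  rcases hz with hz | hz
  · rw [boundaryExt, if_neg fun h0 => by simp [h0] at hz, tendsto_iff_norm_sub_tendsto_zero]
    have hlim : Tendsto (fun ε : ℝ => C * ‖z + ((s * ε : ℝ) : ℂ) * I - z‖ ^ θ) (𝓝[>] 0)
        (𝓝 0) := by
      have h1 := ((tendsto_shift s z).sub_const z).norm
      rw [sub_self, norm_zero] at h1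
      have h2 := (h1.rpow_const (p := θ) (Or.inr hθ.le)).const_mul C
      rwa [Real.zero_rpow hθ.ne', mul_zero] at h2
    refine squeeze_zero' (Eventually.of_forall fun _ => norm_nonneg _) ?_ hlim
    filter_upwards [eventually_shift hs hz.le hzl] with ε hε
    exact h _ _ hε.1 hz hε.2 hzl
  · rw [boundaryExt, if_pos hz]
    exact tendsto_nhds_limUnder (h.exists_limit hs hθ (by simp [hz]) hzl)

/-- The Hölder estimate persists for the boundary values: shift both points into the open half
plane by the same amount. -/
theorem IsHolderNear.norm_boundaryExt_sub_le [CompleteSpace Y] {F : ℂ → Y} {s : ℝ}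
    (hs : s = 1 ∨ s = -1) {l : ℂ} {C θ r : ℝ} (h : IsHolderNear F s l C θ r) (hθ : 0 < θ)
    {z z' : ℂ} (hz : 0 < s * z.im ∨ z.im = 0) (hzl : ‖z - l‖ < r)
    (hz' : 0 < s * z'.im ∨ z'.im = 0) (hzl' : ‖z' - l‖ < r) :
    ‖boundaryExt F s z - boundaryExt F s z'‖ ≤ C * ‖z - z'‖ ^ θ := by
  have hnn : ∀ {z : ℂ}, 0 < s * z.im ∨ z.im = 0 → 0 ≤ s * z.im := by
    rintro z (h | h)
    · exact h.le
    · simp [h]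
  refine le_of_tendsto ((h.tendsto_boundaryExt hs hθ hz hzl).sub
    (h.tendsto_boundaryExt hs hθ hz' hzl')).norm ?_
  filter_upwards [eventually_shift hs (hnn hz) hzl, eventually_shift hs (hnn hz') hzl'] with ε h1 h2
  have h3 := h _ _ h1.1 h2.1 h1.2 h2.2
  rwa [add_sub_add_right_eq_sub] at h3

theorem holderOnWith_of_norm_le {F : ℂ → Y} {V : Set ℂ} {C θ : ℝ} (hC : 0 ≤ C) (hθ : 0 ≤ θ)
    (h : ∀ z ∈ V, ∀ z' ∈ V, ‖F z - F z'‖ ≤ C * ‖z - z'‖ ^ θ) :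
    HolderOnWith C.toNNReal θ.toNNReal F V := by
  intro z hz z' hz'
  rw [edist_dist, edist_dist, ENNReal.ofReal_rpow_of_nonneg dist_nonneg (by positivity),
    ENNReal.ofNNReal_toNNReal, ← ENNReal.ofReal_mul hC, Real.coe_toNNReal _ hθ, dist_eq_norm,
    dist_eq_norm]
  exact ENNReal.ofReal_le_ofReal (h z hz z' hz')

variable {X H : Type*} [NormedAddCommGroup X] [NormedSpace ℂ X]
  [NormedAddCommGroup H] [InnerProductSpace ℂ H]

theorem extResolvent_of_im_ne_zero (J : X →L[ℂ] H) (T : H →ₗ.[ℂ] H) (s : ℝ) {z : ℂ}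
    (hz : z.im ≠ 0) : extResolvent J T s z = toBoundedForm J (opResolvent T z) := if_neg hz

theorem tendsto_extResolvent_ofReal {J : X →L[ℂ] H} {T : H →ₗ.[ℂ] H} {s : ℝ} {l : ℝ}
    (h : ∃ L, Tendsto (fun ε : ℝ =>
      toBoundedForm J (opResolvent T ((l : ℂ) + ((s * ε : ℝ) : ℂ) * I))) (𝓝[>] 0) (𝓝 L)) :
    Tendsto (fun ε : ℝ => toBoundedForm J (opResolvent T ((l : ℂ) + ((s * ε : ℝ) : ℂ) * I)))
      (𝓝[>] 0) (𝓝 (extResolvent J T s l)) := by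
  rw [extResolvent, if_pos (ofReal_im l)]
  exact tendsto_nhds_limUnder h

/-- Local Hölder continuity yields estimates in the open half plane near each boundary point. -/
theorem exists_isHolderNear_of_locallyHolderOn {J : X →L[ℂ] H} {T : H →ₗ.[ℂ] H} {s : ℝ}
    {U : Set ℝ} (h : LocallyHolderOn (extResolvent J T s) (halfPlaneWith s U)) {l : ℝ}
    (hl : l ∈ U) : ∃ C θ r : ℝ, 0 ≤ C ∧ 0 < θ ∧ 0 < r ∧
      IsHolderNear (fun z => toBoundedForm J (opResolvent T z)) s l C θ r := by
  obtain ⟨C, θ, hθ, -, V, hV, hF⟩ := h (l : ℂ) (Or.inr ⟨ofReal_im l, by simpa using hl⟩)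
  obtain ⟨r, hr, hrV⟩ := Metric.mem_nhdsWithin_iff.mp hV
  refine ⟨C, θ, r, C.2, hθ, hr, fun z z' hz hz' hzl hzl' => ?_⟩
  have hmem : ∀ {z : ℂ}, 0 < s * z.im → ‖z - l‖ < r → z ∈ V := fun hz hzl =>
    hrV ⟨by rwa [Metric.mem_ball, dist_eq_norm], Or.inl hz⟩
  have h1 := hF.dist_le (hmem hz hzl) (hmem hz' hzl')
  rw [dist_eq_norm, dist_eq_norm,
    extResolvent_of_im_ne_zero J T s fun h0 => by simp [h0] at hz,
    extResolvent_of_im_ne_zero J T s fun h0 => by simp [h0] at hz'] at h1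
  exact h1

theorem norm_toBoundedForm_le (J : X →L[ℂ] H) (S : H →L[ℂ] H) :
    ‖toBoundedForm J S‖ ≤ ‖J‖ ^ 2 * ‖S‖ := by
  refine ContinuousLinearMap.opNorm_le_bound₂ _ (by positivity) fun x y => ?_
  change ‖⟪J y, S (J x)⟫_ℂ‖ ≤ _
  calc ‖⟪J y, S (J x)⟫_ℂ‖ ≤ ‖J y‖ * ‖S (J x)‖ := norm_inner_le_norm _ _
    _ ≤ (‖J‖ * ‖y‖) * (‖S‖ * (‖J‖ * ‖x‖)) := by
      gcongr
      · exact J.le_opNorm y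
      · exact (S.le_opNorm _).trans (by gcongr; exact J.le_opNorm x)
    _ = _ := by ring

theorem toBoundedForm_sub (J : X →L[ℂ] H) (S S' : H →L[ℂ] H) :
    toBoundedForm J (S - S') = toBoundedForm J S - toBoundedForm J S' := by
  ext x y
  simp [toBoundedForm]

variable [CompleteSpace H]

/-- Inside the open half plane, the resolvent is locally Lipschitz. -/
theorem exists_holderOnWith_of_im_ne_zero (J : X →L[ℂ] H) {T : H →ₗ.[ℂ] H} (hT : IsSelfAdjoint T)
    (s : ℝ) {z : ℂ} (hz : z.im ≠ 0) :
    ∃ C : ℝ≥0, ∃ V ∈ 𝓝 z, HolderOnWith C (1 : ℝ).toNNReal (extResolvent J T s) V := by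
  set r := |z.im| / 2 with hr
  have hz0 : 0 < |z.im| := abs_pos.mpr hz
  have hr0 : 0 < r := by positivity
  have him : ∀ w ∈ Metric.ball z r, r ≤ |w.im| := by
    intro w hw
    rw [Metric.mem_ball, dist_eq_norm] at hw
    have h1 := (abs_im_le_norm (w - z)).trans hw.le
    rw [sub_im] at h1
    have h2 := abs_sub_abs_le_abs_sub z.im w.im
    rw [abs_sub_comm] at h2
    linarith
  refine ⟨(‖J‖ ^ 2 * (1 / r * (1 / r))).toNNReal, Metric.ball z r, Metric.ball_mem_nhds z hr0,
    holderOnWith_of_norm_le (by positivity) zero_le_one fun w hw w' hw' => ?_⟩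
  rw [extResolvent_of_im_ne_zero J T s (abs_pos.mp (hr0.trans_le (him w hw))),
    extResolvent_of_im_ne_zero J T s (abs_pos.mp (hr0.trans_le (him w' hw'))),
    ← toBoundedForm_sub, Real.rpow_one, mul_assoc]
  refine (norm_toBoundedForm_le _ _).trans ?_
  gcongr
  exact norm_opResolvent_sub_le hT hr0 (him w hw) (him w' hw')

/-- Smoothness reduces to Hölder estimates in the open half planes near the points of `U`. -/
theorem isSmoothOn_of_isHolderNear {J : X →L[ℂ] H} {T : H →ₗ.[ℂ] H} (hJ : IsGelfandTriple J)
    (hT : IsSelfAdjoint T) {U : Set ℝ} (hU : IsOpen U) (hU0 : MeasureTheory.volume Uᶜ = 0)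
    (h : ∀ s : ℝ, s = 1 ∨ s = -1 → ∀ l ∈ U, ∃ C θ r : ℝ, 0 ≤ C ∧ 0 < θ ∧ θ ≤ 1 ∧ 0 < r ∧
      IsHolderNear (fun z => toBoundedForm J (opResolvent T z)) s (l : ℝ) C θ r) :
    IsSmoothOn J T U := by
  refine ⟨hJ, hT, hU, hU0, fun s hs l hl => ?_, fun s hs z hz => ?_⟩
  · obtain ⟨C, θ, r, -, hθ, -, hr, hH⟩ := h s hs l hl
    exact hH.exists_limit hs hθ (by simp) (by simpa using hr)
  · by_cases him : z.im = 0
    · have hl : z.re ∈ U := by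
        rcases hz with hz | hz
        · simp [him] at hz
        · exact hz.2
      have hzre : ((z.re : ℝ) : ℂ) = z := Complex.ext rfl (by simp [him])
      obtain ⟨C, θ, r, hC, hθ, hθ1, hr, hH⟩ := h s hs z.re hl
      rw [hzre] at hH
      refine ⟨C.toNNReal, θ.toNNReal, Real.toNNReal_pos.mpr hθ, Real.toNNReal_le_one.mpr hθ1,
        Metric.ball z r ∩ halfPlaneWith s U,
        Filter.inter_mem (mem_nhdsWithin_of_mem_nhds (Metric.ball_mem_nhds z hr))
          self_mem_nhdsWithin, ?_⟩
      refine holderOnWith_of_norm_le hC hθ.le fun w hw w' hw' => ?_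
      have hmem : ∀ {w : ℂ}, w ∈ Metric.ball z r ∩ halfPlaneWith s U →
          (0 < s * w.im ∨ w.im = 0) ∧ ‖w - z‖ < r := fun hw =>
        ⟨hw.2.imp_right And.left, by simpa [dist_eq_norm] using hw.1⟩
      exact hH.norm_boundaryExt_sub_le hs hθ (hmem hw).1 (hmem hw).2 (hmem hw').1 (hmem hw').2
    · obtain ⟨C, V, hV, hF⟩ := exists_holderOnWith_of_im_ne_zero J hT s him
      exact ⟨C, _, by simp, by simp, V, mem_nhdsWithin_of_mem_nhds hV, hF⟩

end Boundary

/-! ### Block diagonal resolvents -/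

section Shifted

variable {ι XA X EA H : Type*} [NormedAddCommGroup XA] [InnerProductSpace ℂ XA]
  [NormedAddCommGroup X] [InnerProductSpace ℂ X]
  [NormedAddCommGroup EA] [InnerProductSpace ℂ EA]
  [NormedAddCommGroup H] [InnerProductSpace ℂ H]

/-- With respect to the block decomposition `τ` of `X`, the resolvent of `T` as an operator from `X`
to `X*` is the direct sum of the weighted and shifted resolvents `wₙ R_A(z - μₙ)`. -/
structure IsBlockResolvent (J : X →L[ℂ] H) (T : H →ₗ.[ℂ] H) (JA : XA →L[ℂ] EA)
    (A : EA →ₗ.[ℂ] EA) (τ : ι → XA →ₗ[ℂ] X) (w μ : ι → ℝ) : Prop where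
  decomposition : IsBlockDecomposition τ
  weight_nonneg : ∀ n, 0 ≤ w n
  diag : ∀ z : ℂ, z.im ≠ 0 → ∀ n x y, toBoundedForm J (opResolvent T z) (τ n x) (τ n y)
    = ((w n : ℂ) • toBoundedForm JA (opResolvent A (z - μ n))) x y
  offDiag : ∀ z : ℂ, z.im ≠ 0 → ∀ n m x y, n ≠ m →
    toBoundedForm J (opResolvent T z) (τ n x) (τ m y) = 0

variable {J : X →L[ℂ] H} {T : H →ₗ.[ℂ] H} {JA : XA →L[ℂ] EA} {A : EA →ₗ.[ℂ] EA}
  {τ : ι → XA →ₗ[ℂ] X} {w μ : ι → ℝ}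

theorem IsBlockResolvent.norm_sub_le (h : IsBlockResolvent J T JA A τ w μ) {z z' : ℂ}
    (hz : z.im ≠ 0) (hz' : z'.im ≠ 0) {M : ℝ} (hM : 0 ≤ M)
    (hb : ∀ n, w n * ‖toBoundedForm JA (opResolvent A (z - μ n))
      - toBoundedForm JA (opResolvent A (z' - μ n))‖ ≤ M) :
    ‖toBoundedForm J (opResolvent T z) - toBoundedForm J (opResolvent T z')‖ ≤ M := by
  refine norm_le_of_blockDiagonal h.decomposition (b := fun n => (w n : ℂ) •
    (toBoundedForm JA (opResolvent A (z - μ n)) - toBoundedForm JA (opResolvent A (z' - μ n))))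
    hM (fun n => ?_) (fun n x y => ?_) fun n m x y hnm => ?_
  · refine (ContinuousLinearMap.opNorm_smul_le _ _).trans ?_
    rw [norm_real, Real.norm_of_nonneg (h.weight_nonneg n)]
    exact hb n
  · rw [sub_apply, sub_apply, h.diag z hz, h.diag z' hz']
    exact (mul_sub _ _ _).symm
  · rw [sub_apply, sub_apply, h.offDiag z hz _ _ _ _ hnm, h.offDiag z' hz' _ _ _ _ hnm, sub_zero]

theorem tendsto_form_apply {Z α : Type*} [NormedAddCommGroup Z] [NormedSpace ℂ Z] {k : Filter α}
    {f : α → Z →L[ℂ] (Z →L⋆[ℂ] ℂ)} {K : Z →L[ℂ] (Z →L⋆[ℂ] ℂ)} (hf : Tendsto f k (𝓝 K)) (x y : Z) :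
    Tendsto (fun a => f a x y) k (𝓝 (K x y)) := by
  have h1 := ((continuous_eval_const (F := Z →L[ℂ] (Z →L⋆[ℂ] ℂ)) x).tendsto K).comp hf
  exact ((continuous_eval_const (F := Z →L⋆[ℂ] ℂ) y).tendsto _).comp h1

/-- The block decomposition passes to the boundary values. -/
theorem IsBlockResolvent.norm_limit_le (h : IsBlockResolvent J T JA A τ w μ) {s : ℝ}
    (hs : s = 1 ∨ s = -1) {l : ℝ} {L : X →L[ℂ] (X →L⋆[ℂ] ℂ)}
    (hL : Tendsto (fun ε : ℝ => toBoundedForm J (opResolvent T ((l : ℂ) + ((s * ε : ℝ) : ℂ) * I)))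
      (𝓝[>] 0) (𝓝 L)) {LA : ι → XA →L[ℂ] (XA →L⋆[ℂ] ℂ)}
    (hLA : ∀ n, Tendsto (fun ε : ℝ =>
      toBoundedForm JA (opResolvent A (((l - μ n : ℝ) : ℂ) + ((s * ε : ℝ) : ℂ) * I)))
      (𝓝[>] 0) (𝓝 (LA n))) {M : ℝ} (hM : 0 ≤ M) (hb : ∀ n, w n * ‖LA n‖ ≤ M) : ‖L‖ ≤ M := by
  have him : ∀ᶠ ε : ℝ in 𝓝[>] 0, ((l : ℂ) + ((s * ε : ℝ) : ℂ) * I).im ≠ 0 := by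
    filter_upwards [self_mem_nhdsWithin] with ε hε h0
    have := shift_pos hs (z := (l : ℂ)) (by simp) hε
    rw [h0, mul_zero] at this
    exact lt_irrefl _ this
  refine norm_le_of_blockDiagonal h.decomposition (b := fun n => (w n : ℂ) • LA n)
    hM (fun n => ?_) (fun n x y => ?_) fun n m x y hnm => ?_
  · refine (ContinuousLinearMap.opNorm_smul_le _ _).trans ?_
    rw [norm_real, Real.norm_of_nonneg (h.weight_nonneg n)]
    exact hb n
  · refine tendsto_nhds_unique (tendsto_form_apply hL _ _) ?_
    refine ((tendsto_form_apply (hLA n) x y).const_mul (w n : ℂ)).congr' ?_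
    filter_upwards [him] with ε hε
    rw [h.diag _ hε]
    have hz : (l : ℂ) + ((s * ε : ℝ) : ℂ) * I - μ n
        = ((l - μ n : ℝ) : ℂ) + ((s * ε : ℝ) : ℂ) * I := by
      push_cast
      ring
    rw [hz]
    rfl
  · refine tendsto_nhds_unique (tendsto_form_apply hL _ _) (tendsto_const_nhds.congr' ?_)
    filter_upwards [him] with ε hε
    rw [h.offDiag _ hε _ _ _ _ hnm]

end Shifted

/-! ### Uniform estimates over the blocks -/

section Uniform

/-- Finitely many Hölder estimates hold with common constants. -/
theorem exists_common_isHolderNear {ι Y : Type*} [NormedAddCommGroup Y] {F : ℂ → Y} {s : ℝ}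
    {l : ι → ℂ} {N : Set ι} (hN : N.Finite)
    (h : ∀ n ∈ N, ∃ C θ r : ℝ, 0 ≤ C ∧ 0 < θ ∧ 0 < r ∧ IsHolderNear F s (l n) C θ r) :
    ∃ C θ r : ℝ, 0 ≤ C ∧ 0 < θ ∧ 0 < r ∧ ∀ n ∈ N, IsHolderNear F s (l n) C θ r := by
  induction N, hN using Set.Finite.induction_on with
  | empty => exact ⟨0, 1, 1, le_rfl, one_pos, one_pos, by simp⟩
  | @insert a N _ _ ih =>
    obtain ⟨C₁, θ₁, r₁, hC₁, hθ₁, hr₁, h₁⟩ := h a (Set.mem_insert a N)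
    obtain ⟨C₂, θ₂, r₂, hC₂, hθ₂, hr₂, h₂⟩ := ih fun n hn => h n (Set.mem_insert_of_mem a hn)
    refine ⟨max C₁ C₂, min θ₁ θ₂, min (min r₁ r₂) (1 / 2), le_max_of_le_left hC₁,
      lt_min hθ₁ hθ₂, lt_min (lt_min hr₁ hr₂) (by norm_num), ?_⟩
    rintro n (rfl | hn)
    · exact h₁.mono (le_max_of_le_left hC₁) (le_max_left _ _) (lt_min hθ₁ hθ₂) (min_le_left _ _)
        ((min_le_left _ _).trans (min_le_left _ _)) (min_le_right _ _)
    · exact (h₂ n hn).mono (le_max_of_le_left hC₁) (le_max_right _ _) (lt_min hθ₁ hθ₂)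
        (min_le_right _ _) ((min_le_left _ _).trans (min_le_right _ _)) (min_le_right _ _)

variable {ι XA X EA H : Type*} [NormedAddCommGroup XA] [InnerProductSpace ℂ XA]
  [NormedAddCommGroup X] [InnerProductSpace ℂ X]
  [NormedAddCommGroup EA] [InnerProductSpace ℂ EA]
  [NormedAddCommGroup H] [InnerProductSpace ℂ H]
  {J : X →L[ℂ] H} {T : H →ₗ.[ℂ] H} {JA : XA →L[ℂ] EA} {A : EA →ₗ.[ℂ] EA}
  {τ : ι → XA →ₗ[ℂ] X} {w μ : ι → ℝ}

/-- Near a point `l`, only finitely many of the shifted points `l - μₙ` are not in the high-energy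
regime where the Hölder estimate of the blocks is uniform. -/
theorem IsBlockResolvent.exists_isHolderNear (h : IsBlockResolvent J T JA A τ w μ)
    (hw : ∀ n, w n ≤ 1) (hμ : ∀ K, {n | |μ n| ≤ K}.Finite) {UA : Set ℝ} {s : ℝ}
    (hloc : LocallyHolderOn (extResolvent JA A s) (halfPlaneWith s UA))
    {L θ₀ c δ : ℝ} (hθ₀ : 0 < θ₀) (hθ₀1 : θ₀ ≤ 1) (hc : 0 < c) (hδ : 0 < δ)
    (hunif : ∀ z ∈ halfPlaneWith s UA, ∀ z' ∈ halfPlaneWith s UA,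
        L ≤ |z.re| → L ≤ |z'.re| → s * z.im ≤ δ → s * z'.im ≤ δ → ‖z - z'‖ ≤ 1 →
        ‖extResolvent JA A s z - extResolvent JA A s z'‖ ≤ c * ‖z - z'‖ ^ θ₀)
    (hs : s = 1 ∨ s = -1) {l : ℝ} (hl : ∀ n, l - μ n ∈ UA) :
    ∃ C θ r : ℝ, 0 ≤ C ∧ 0 < θ ∧ θ ≤ 1 ∧ 0 < r ∧
      IsHolderNear (fun z => toBoundedForm J (opResolvent T z)) s (l : ℝ) C θ r := by
  obtain ⟨C, θ, r, hC, hθ, hr, hN⟩ := exists_common_isHolderNear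
    (F := fun z => toBoundedForm JA (opResolvent A z)) (s := s)
    (l := fun n => ((l - μ n : ℝ) : ℂ)) (hμ (|l| + L + 1)) fun n _ =>
      exists_isHolderNear_of_locallyHolderOn hloc (hl n)
  set r' := min (min r δ) (1 / 2) with hr'
  have hr'0 : 0 < r' := lt_min (lt_min hr hδ) (by norm_num)
  have hr'h : r' ≤ 1 / 2 := min_le_right _ _
  have hr'δ : r' ≤ δ := (min_le_left _ _).trans (min_le_right _ _)
  have hθ' : 0 < min θ θ₀ := lt_min hθ hθ₀
  have hC' : 0 ≤ max C c := le_max_of_le_left hC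
  have hblocks : ∀ n, IsHolderNear (fun z => toBoundedForm JA (opResolvent A z)) s
      ((l - μ n : ℝ) : ℂ) (max C c) (min θ θ₀) r' := by
    intro n
    by_cases hn : |μ n| ≤ |l| + L + 1
    · exact (hN n hn).mono hC' (le_max_left _ _) hθ' (min_le_left _ _)
        ((min_le_left _ _).trans (min_le_left _ _)) hr'h
    -- `|μ n|` is large, so that the disc about `l - μ n` lies in the region of high energies
    · have hfar : IsHolderNear (fun z => toBoundedForm JA (opResolvent A z)) s
          ((l - μ n : ℝ) : ℂ) c θ₀ r' := by
        have hre : ∀ {z : ℂ}, ‖z - ((l - μ n : ℝ) : ℂ)‖ < r' → L ≤ |z.re| := by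
          intro z hz
          have h1 := (abs_re_le_norm _).trans hz.le
          rw [sub_re, ofReal_re] at h1
          have h2 := abs_sub_abs_le_abs_sub (μ n) l
          have h3 := abs_sub_abs_le_abs_sub (l - μ n) z.re
          rw [abs_sub_comm] at h2
          rw [abs_sub_comm (l - μ n)] at h3
          push Not at hn
          linarith
        have him : ∀ {z : ℂ}, ‖z - ((l - μ n : ℝ) : ℂ)‖ < r' → s * z.im ≤ δ := by
          intro z hz
          have h1 := (abs_im_le_norm _).trans hz.le
          rw [sub_im, ofReal_im, sub_zero] at h1
          have h2 : s * z.im ≤ |z.im| := by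
            rcases hs with rfl | rfl
            · rw [one_mul]; exact le_abs_self _
            · rw [neg_one_mul]; exact neg_le_abs _
          linarith
        intro z z' hz hz' hzl hzl'
        have h1 : ‖z - z'‖ ≤ 1 := by
          calc ‖z - z'‖ = ‖(z - ((l - μ n : ℝ) : ℂ)) - (z' - ((l - μ n : ℝ) : ℂ))‖ := by
                rw [sub_sub_sub_cancel_right]
            _ ≤ _ := _root_.norm_sub_le _ _
            _ ≤ 1 := by linarith
        have h2 := hunif z (Or.inl hz) z' (Or.inl hz') (hre hzl) (hre hzl') (him hzl) (him hzl') h1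
        rwa [extResolvent_of_im_ne_zero JA A s fun h0 => by simp [h0] at hz,
          extResolvent_of_im_ne_zero JA A s fun h0 => by simp [h0] at hz'] at h2
      exact hfar.mono hC' (le_max_right _ _) hθ' (min_le_right _ _) le_rfl hr'h
  refine ⟨max C c, min θ θ₀, r', hC', hθ', (min_le_right _ _).trans hθ₀1, hr'0, ?_⟩
  intro z z' hz hz' hzl hzl'
  refine h.norm_sub_le (fun h0 => by simp [h0] at hz) (fun h0 => by simp [h0] at hz')
    (by positivity) fun n => ?_
  have hdist : ∀ {z : ℂ}, ‖z - l‖ < r' → ‖(z - μ n) - ((l - μ n : ℝ) : ℂ)‖ < r' := by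
    intro z hz
    push_cast
    rwa [sub_sub_sub_cancel_right]
  have h1 := hblocks n (z - μ n) (z' - μ n) (by simpa using hz) (by simpa using hz') (hdist hzl)
    (hdist hzl')
  rw [sub_sub_sub_cancel_right] at h1
  refine le_trans ?_ h1
  exact mul_le_of_le_one_left (norm_nonneg (toBoundedForm JA (opResolvent A (z - μ n))
    - toBoundedForm JA (opResolvent A (z' - μ n)))) (hw n)

/-- Peetre's inequality. -/
theorem one_add_sq_le_peetre (l m : ℝ) : 1 + l ^ 2 ≤ 2 * (1 + m ^ 2) * (1 + (l - m) ^ 2) := by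
  nlinarith [sq_nonneg (l - 2 * m), sq_nonneg (m * (l - m)), sq_nonneg m, sq_nonneg (l - m)]

theorem one_add_sub_sq_rpow_le {β : ℝ} (hβ : 0 ≤ β) {l : ℝ} (hl : l ≠ 0) (m : ℝ) :
    (1 + (l - m) ^ 2) ^ (-β / 2) ≤ 2 ^ (β / 2) * (1 + m ^ 2) ^ (β / 2) * |l| ^ (-β) := by
  have h1 : l ^ 2 / (2 * (1 + m ^ 2)) ≤ 1 + (l - m) ^ 2 := by
    rw [div_le_iff₀ (by positivity)]
    linarith [one_add_sq_le_peetre l m]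
  have hl0 : 0 < |l| := abs_pos.mpr hl
  have hl2 : 0 < l ^ 2 := by positivity
  have e : |l| ^ (-β) = (l ^ 2) ^ (-(β / 2)) := by
    rw [← sq_abs l, ← Real.rpow_natCast |l| 2, ← Real.rpow_mul hl0.le]
    congr 1
    push_cast
    ring
  calc (1 + (l - m) ^ 2) ^ (-β / 2) ≤ (l ^ 2 / (2 * (1 + m ^ 2))) ^ (-β / 2) :=
        Real.rpow_le_rpow_of_nonpos (by positivity) h1 (by linarith)
    _ = 2 ^ (β / 2) * (1 + m ^ 2) ^ (β / 2) * |l| ^ (-β) := by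
        rw [e, neg_div, Real.div_rpow hl2.le (by positivity), Real.rpow_neg (by positivity :
          (0 : ℝ) ≤ 2 * (1 + m ^ 2)), div_inv_eq_mul, Real.mul_rpow zero_le_two (by positivity)]
        ring

/-- The decay of the blocks carries over if the weights absorb the factor `(1 + μₙ²)^(β/2)` that
Peetre's inequality produces. -/
theorem IsBlockResolvent.isOfHighEnergyOrderOn (h : IsBlockResolvent J T JA A τ w μ)
    {U UA : Set ℝ} (hU : ∀ l ∈ U, ∀ n, l - μ n ∈ UA)
    (hlim : ∀ s : ℝ, s = 1 ∨ s = -1 → ∀ l ∈ U, ∃ L, Tendsto (fun ε : ℝ =>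
      toBoundedForm J (opResolvent T ((l : ℂ) + ((s * ε : ℝ) : ℂ) * I))) (𝓝[>] 0) (𝓝 L))
    (hlimA : ∀ s : ℝ, s = 1 ∨ s = -1 → ∀ l ∈ UA, ∃ L, Tendsto (fun ε : ℝ =>
      toBoundedForm JA (opResolvent A ((l : ℂ) + ((s * ε : ℝ) : ℂ) * I))) (𝓝[>] 0) (𝓝 L))
    {β c D : ℝ} (hβ : 0 ≤ β) (hc : 0 < c)
    (hdecay : ∀ s : ℝ, s = 1 ∨ s = -1 → ∀ l ∈ UA,
      ‖extResolvent JA A s (l : ℂ)‖ ≤ c * (1 + l ^ 2) ^ (-β / 2))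
    (hD : ∀ n, w n * (1 + μ n ^ 2) ^ (β / 2) ≤ D) : IsOfHighEnergyOrderOn J T U β := by
  have hM : 0 < c * 2 ^ (β / 2) * max D 1 := by positivity
  refine ⟨1, c * 2 ^ (β / 2) * max D 1, one_pos, hM, fun s hs l hl hl1 => ?_⟩
  have hl0 : l ≠ 0 := fun h0 => by
    rw [h0, abs_zero] at hl1
    linarith
  refine h.norm_limit_le hs (tendsto_extResolvent_ofReal (hlim s hs l hl))
    (fun n => tendsto_extResolvent_ofReal (hlimA s hs _ (hU l hl n))) (by positivity) fun n => ?_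
  calc w n * ‖extResolvent JA A s ((l - μ n : ℝ) : ℂ)‖
      ≤ w n * (c * (2 ^ (β / 2) * (1 + μ n ^ 2) ^ (β / 2) * |l| ^ (-β))) := by
        refine mul_le_mul_of_nonneg_left ?_ (h.weight_nonneg n)
        refine (hdecay s hs _ (hU l hl n)).trans ?_
        gcongr
        exact one_add_sub_sq_rpow_le hβ hl0 (μ n)
    _ = c * 2 ^ (β / 2) * (w n * (1 + μ n ^ 2) ^ (β / 2)) * |l| ^ (-β) := by ring
    _ ≤ c * 2 ^ (β / 2) * max D 1 * |l| ^ (-β) := by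
        gcongr
        exact (hD n).trans (le_max_left _ _)

end Uniform

/-! ### The exceptional set -/

section Exceptional

/-- If the `μₙ` do not accumulate, the points all of whose translates by the `-μₙ` avoid a given
finite set form an open set of full measure. -/
theorem isOpen_and_volume_compl_of_finite {ι : Type*} {μ : ι → ℝ}
    (hμ : ∀ K, {n | |μ n| ≤ K}.Finite) {UA : Set ℝ} (hUA : UAᶜ.Finite) :
    IsOpen {l | ∀ n, l - μ n ∈ UA} ∧ MeasureTheory.volume {l | ∀ n, l - μ n ∈ UA}ᶜ = 0 := by
  have hcompl : {l | ∀ n, l - μ n ∈ UA}ᶜ = ⋃ n, (fun x => x + μ n) '' UAᶜ := by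
    ext l
    simp only [Set.mem_compl_iff, Set.mem_ofPred_eq, not_forall, Set.mem_iUnion, Set.mem_image]
    exact exists_congr fun n => ⟨fun h => ⟨l - μ n, h, sub_add_cancel _ _⟩,
      fun ⟨x, hx, hxl⟩ => by rwa [← hxl, add_sub_cancel_right]⟩
  constructor
  · rw [← isClosed_compl_iff, hcompl]
    refine LocallyFinite.isClosed_iUnion (fun x => ?_) fun n => (hUA.image _).isClosed
    obtain ⟨M, hM⟩ := hUA.isBounded.exists_norm_le
    refine ⟨Metric.ball x 1, Metric.ball_mem_nhds x one_pos,
      (hμ (|x| + 1 + M)).subset ?_⟩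
    rintro n ⟨_, ⟨y, hy, rfl⟩, hyx⟩
    have h1 : |y| ≤ M := hM y hy
    have h2 : |y + μ n - x| < 1 := by simpa [Real.dist_eq] using hyx
    have h3 : |μ n| ≤ |y + μ n - x| + |x| + |y| := by
      calc |μ n| = |(y + μ n - x) + x - y| := by congr 1; ring
        _ ≤ _ := (abs_sub _ _).trans (add_le_add_left (abs_add_le _ _) _)
    change |μ n| ≤ _
    linarith
  · rw [hcompl]
    have hι : Countable ι := by
      rw [← Set.countable_univ_iff]
      refine (Set.countable_iUnion fun K : ℕ => (hμ K).countable).mono fun n _ => ?_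
      obtain ⟨K, hK⟩ := exists_nat_ge |μ n|
      exact Set.mem_iUnion.mpr ⟨K, hK⟩
    exact (Set.countable_iUnion fun n => (hUA.image _).countable).measure_zero _

end Exceptional

/-! ### The tensor product as a block diagonal operator -/

section Conclusion

variable {XA EA EB : Type*}
  [NormedAddCommGroup XA] [InnerProductSpace ℂ XA]
  [NormedAddCommGroup EA] [InnerProductSpace ℂ EA] [CompleteSpace EA]
  [NormedAddCommGroup EB] [InnerProductSpace ℂ EB] [CompleteSpace EB]

/-- The weight `(1 + μₙ²)^(-γ)` of a block is the square of the factor by which the basis vector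
`(1 + μₙ²)^(-γ/2) eₙ` of the weighted space differs from `eₙ`. -/
theorem isBlockResolvent_tensorSum (JA : XA →L[ℂ] EA) {A : EA →ₗ.[ℂ] EA} {B : EB →ₗ.[ℂ] EB}
    (hA : IsSelfAdjoint A) (hB : IsSelfAdjoint B) {γ : ℝ} (hγ : 0 < γ) {ι : Type*}
    (e : HilbertBasis ι ℂ EB) {μ : ι → ℝ} (he : ∀ n, IsEigenpair B (μ n) (e n)) :
    IsBlockResolvent (hilbertTensorMap JA (WeightedSpace.incl B hB hγ)) (tensorSum A B) JA A
      (fun n => ((hilbertTmulL XA (WeightedSpace B hB γ)).flip (weightedBasis hB hγ e n) :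
        XA →ₗ[ℂ] HilbertTensor XA (WeightedSpace B hB γ)))
      (fun n => (1 + μ n ^ 2) ^ (-γ)) μ := by
  have hT := isSelfAdjoint_tensorSum hA hB e he
  have key : ∀ z : ℂ, z.im ≠ 0 → ∀ n m x y,
      toBoundedForm (hilbertTensorMap JA (WeightedSpace.incl B hB hγ))
        (opResolvent (tensorSum A B) z) (hilbertTmul x (weightedBasis hB hγ e n))
        (hilbertTmul y (weightedBasis hB hγ e m))
      = toBoundedForm JA (opResolvent A (z - μ n)) x y
        * ((((1 + μ n ^ 2) ^ (-(γ / 2)) * (1 + μ m ^ 2) ^ (-(γ / 2)) : ℝ) : ℂ) *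
          ⟪e m, e n⟫_ℂ) := by
    intro z hz n m x y
    have h1 : ∀ k a, hilbertTensorMap JA (WeightedSpace.incl B hB hγ)
        (hilbertTmul a (weightedBasis hB hγ e k))
        = (((1 + μ k ^ 2) ^ (-(γ / 2)) : ℝ) : ℂ) • hilbertTmul (JA a) (e k) := fun k a => by
      rw [hilbertTensorMap_hilbertTmul, incl_weightedBasis hB hγ e (he k), hilbertTmul_smul_right]
    change ⟪hilbertTensorMap JA (WeightedSpace.incl B hB hγ) _, opResolvent (tensorSum A B) z
      (hilbertTensorMap JA (WeightedSpace.incl B hB hγ) _)⟫_ℂ = ⟪JA y, _⟫_ℂ * _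
    rw [h1, h1, map_smul, opResolvent_tensorSum_hilbertTmul hA hB hT (he n) hz, inner_smul_left,
      inner_smul_right, inner_hilbertTmul, conj_ofReal]
    push_cast
    change _ = ⟪JA y, opResolvent A (z - μ n) (JA x)⟫_ℂ * _
    ring
  refine ⟨isBlockDecomposition_hilbertTensor _, fun n => by positivity, fun z hz n x y => ?_,
    fun z hz n m x y hnm => ?_⟩
  · refine (key z hz n n x y).trans ?_
    have h2 : (1 + μ n ^ 2) ^ (-(γ / 2)) * (1 + μ n ^ 2) ^ (-(γ / 2)) = (1 + μ n ^ 2) ^ (-γ) := by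
      rw [← Real.rpow_add (by positivity)]
      congr 1
      ring
    rw [h2, inner_self_eq_norm_sq_to_K, e.orthonormal.1]
    simp [mul_comm]
  · refine (key z hz n m x y).trans ?_
    rw [e.orthonormal.2 hnm.symm, mul_zero, mul_zero]

end Conclusion

end SmoothMethod

end
open SmoothMethod

theorem theorem4p12
    {XA EA EB : Type*}
    [NormedAddCommGroup XA] [InnerProductSpace ℂ XA] [CompleteSpace XA]
    [NormedAddCommGroup EA] [InnerProductSpace ℂ EA] [CompleteSpace EA]
    [NormedAddCommGroup EB] [InnerProductSpace ℂ EB] [CompleteSpace EB]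
    (JA : XA →L[ℂ] EA) (HA : EA →ₗ.[ℂ] EA) (HB : EB →ₗ.[ℂ] EB) (hHB : IsSelfAdjoint HB)
    -- smoothness of `HA`, with respect to a set of finite complement
    (UA : Set ℝ) (hfin : UAᶜ.Finite) (hsmooth : IsSmoothOn JA HA UA)
    -- uniform Hölder bound at high energies, up to and including the boundary points in `UA`
    (hholder : ∃ L θ c δ : ℝ, 0 < L ∧ θ ∈ Set.Ioo 0 1 ∧ 0 < c ∧ 0 < δ ∧
      ∀ s : ℝ, s = 1 ∨ s = -1 → ∀ z ∈ halfPlaneWith s UA, ∀ z' ∈ halfPlaneWith s UA,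
        L ≤ |z.re| → L ≤ |z'.re| → s * z.im ≤ δ → s * z'.im ≤ δ → ‖z - z'‖ ≤ 1 →
        ‖extResolvent JA HA s z - extResolvent JA HA s z'‖ ≤ c * ‖z - z'‖ ^ θ)
    -- decay of the boundary values of the resolvent
    (β : ℝ) (hβ : β ∈ Set.Ioo 0 1)
    (hdecay : ∃ c : ℝ, 0 < c ∧ ∀ s : ℝ, s = 1 ∨ s = -1 → ∀ l ∈ UA,
      ‖extResolvent JA HA s (l : ℂ)‖ ≤ c * (1 + l ^ 2) ^ (-β / 2))
    -- trace class condition on `HB`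
    (γ : ℝ) (hγ : 0 < γ) (htrace : IsTraceClassPMap (oneAddSqPow HB (-γ + β / 2))) :
    ∃ U : Set ℝ,
      IsSmoothOn (hilbertTensorMap JA (WeightedSpace.incl HB hHB hγ)) (tensorSum HA HB) U ∧
      IsOfHighEnergyOrderOn (hilbertTensorMap JA (WeightedSpace.incl HB hHB hγ))
        (tensorSum HA HB) U β := by
  obtain ⟨w, e, μ, he, hfinite, D, hD⟩ := exists_eigenbasis_of_isTraceClassPMap hHB htrace
  obtain ⟨L, θ, c, δ, -, hθ, hc, hδ, hunif⟩ := hholder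
  obtain ⟨c', hc', hdecay⟩ := hdecay
  have hHA := hsmooth.selfAdjoint
  have hblock := isBlockResolvent_tensorSum JA hHA hHB hγ e he
  obtain ⟨hopen, hnull⟩ := isOpen_and_volume_compl_of_finite hfinite hfin
  have : CompleteSpace (WeightedSpace HB hHB γ) := completeSpace_weightedSpace hHB hγ
  have hgelfand := isGelfandTriple_hilbertTensorMap hsmooth.gelfand.injective
    hsmooth.gelfand.denseRange (incl_injective hHB hγ) (denseRange_incl hHB hγ)
  have hsmooth' : IsSmoothOn (hilbertTensorMap JA (WeightedSpace.incl HB hHB hγ))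
      (tensorSum HA HB) {l | ∀ n, l - μ n ∈ UA} :=
    isSmoothOn_of_isHolderNear hgelfand (isSelfAdjoint_tensorSum hHA hHB e he) hopen hnull
      fun s hs l hl => hblock.exists_isHolderNear
        (fun n => Real.rpow_le_one_of_one_le_of_nonpos (by linarith [sq_nonneg (μ n)])
          (by linarith)) hfinite (hsmooth.holder s hs) hθ.1 hθ.2.le hc hδ (hunif s hs) hs hl
  refine ⟨_, hsmooth', hblock.isOfHighEnergyOrderOn (fun l hl => hl) hsmooth'.exists_limit
    hsmooth.exists_limit (D := D) hβ.1.le hc' hdecay fun n => ?_⟩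
  rw [← Real.rpow_add (by positivity)]
  exact hD n
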